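/- Let $\mathbb K\in\{\mathbb R,\mathbb C\}$, let $X,Y$ be Banach spaces over $\mathbb K$, and let "operator" mean bounded linear operator. \textbf{Definitions.} For a (non-empty) directed set $D$ and $n\in\mathbb N=\{1,2,\dots\}$ put $D^{\le n}=\bigcup_{i=1}^n D^i$; for $t=(u_1,\dots,u_k)$ write $t|_i=(u_1,\dots,u_i)$ and $t\smallfrown u=(u_1,\dots,u_k,u)$. A collection $(x_t)_{t\in D^{\le n}}\subset X$ is \emph{weakly null} if the net $(x_{t\smallfrown u})_{u\in D}$ is weakly null for every $t\in\{\varnothing\}\cup D^{\le n-1}$. $B_X$ and $S_X$ denote the closed unit ball and the unit sphere of $X$. For weak$^*$-compact $K\subset X^*$ let $r_K(x)=\max_{x^*\in K}\mathrm{Re}\,x^*(x)$ ($r_K=0$ if $K=\varnothing$), let $\Sigma_n(K)$ be the infimum of those $s>0$ such that $\inf_{t\in D^n}r_K\big(\sum_{i=1}^n x_{t|_i}\big)\le s$ for every directed set $D$ and every weakly null $(x_t)_{t\in D^{\le n}}\subset B_X$, and let $\Sigma(K)=\sup_n\Sigma_n(K)\in[0,\infty]$. For $\varepsilon>0$ let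 $s_\varepsilon(K)$ be the set of those $x^*\in K$ such that the norm diameter of $V\cap K$ exceeds $\varepsilon$ for every weak$^*$-neighborhood $V$ of $x^*$; for $\varepsilon\le 0$ let $s_\varepsilon(K)=K$. The set $K$ has \emph{summable Szlenk index} if there is $M\ge 0$ such that $\sum_{i=1}^n\varepsilon_i\le M$ whenever $\varepsilon_1,\dots,\varepsilon_n\in\mathbb R$ and $s_{\varepsilon_1}\cdots s_{\varepsilon_n}(K)\ne\varnothing$. For an operator $A:X\to Y$ let $\Sigma(A)=\Sigma(A^*B_{Y^*})$; $A$ has \emph{summable Szlenk index} if $A^*B_{Y^*}$ does. Let $\{X\}_n$ be the set of norms $|\cdot|$ on $\mathbb K^n$ such that for every $b>1$ there are a directed set $D$ and a weakly null collection $(x_t)_{t\in D^{\le n}}\subset S_X$ with $$b^{-1}\Big\|\sum_{i=1}^n a_ix_{t|_i}\Big\|\le\Big|\sum_{i=1}^n a_ie_i\Big|\le b\Big\|\sum_{i=1}^n a_ix_{t|_i}\Big\|$$ for all $t\in D^n$ and all scalars $a_1,\dots,a_n$ with $\max_i|a_i|=1$. The space $X$ is \emph{Asymptotic $c_0$} if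 $\dim X=\infty$ and there is $C\ge 1$ with $C^{-1}\max_i|a_i|\le|\sum_{i=1}^n a_ie_i|\le C\max_i|a_i|$ for all $n\in\mathbb N$, all $|\cdot|\in\{X\}_n$ and all $(a_i)\in\mathbb K^n$. An \emph{FDD} of $X$ is a sequence $E=(E_n)_{n=1}^\infty$ of finite-dimensional subspaces such that each $x\in X$ has a unique expansion $x=\sum_{n=1}^\infty x_n$ (norm convergent) with $x_n\in E_n$; put $P_m^Ex=\sum_{n=1}^m x_n$. It is \emph{shrinking} if $\bigcup_m(P_m^E)^*(X^*)$ is norm dense in $X^*$. A \emph{blocking} of $E$ is a sequence $F_n=\bigoplus_{i=m_{n-1}+1}^{m_n}E_i$ with $0=m_0<m_1<\cdots$. An FDD $E$ is \emph{asymptotic $c_0$ in $X$} if there is $C\ge1$ such that $C^{-1}\max_i\|x_i\|\le\|\sum_{i=1}^n x_i\|\le C\max_i\|x_i\|$ for all $n\in\mathbb N$, all $n\le k_0<k_1<\cdots<k_n$ and all $x_i\in\bigoplus_{j=k_{i-1}}^{k_i-1}E_j$. \textbf{Theorem.} (a) For every operator $A:X\to Y$, (i) $\Sigma(A)<\infty$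 if and only if (ii) $A$ has summable Szlenk index. (b) If $\dim X=\infty$ and $A=I_X$, then (i) and (ii) are also equivalent to (iii) $X$ is Asymptotic $c_0$. (c) If $\dim X=\infty$, $A=I_X$, and $E$ is a shrinking FDD of $X$, then (i), (ii), (iii) are also equivalent to (iv) there is a blocking $F$ of $E$ which is asymptotic $c_0$ in $X$. -/

import Mathlib

open Filter Topology
open scoped ENNReal

universe u v

namespace SummableSzlenk

section Trees

variable {𝕜 : Type*} [RCLike 𝕜] {X : Type u} [NormedAddCommGroup X] [NormedSpace 𝕜 X]

/-- Collections `(x_t)` indexed by `D^{≤ n}`, the non-empty sequences of length at most `n` in a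
directed set `D`, are given by maps `x : List D → X`; only the values at lists of length
`1, …, n` matter.  The restriction `t|_i` is `t.take i`, and `t ⌢ u` is `t ++ [u]`.

The collection is weakly null if `(x_{t ⌢ u})_{u ∈ D}` is a weakly null net for every `t`
of length less than `n` (including the empty sequence). -/
def IsWeaklyNull (𝕜 : Type*) [RCLike 𝕜] {X : Type u} [NormedAddCommGroup X] [NormedSpace 𝕜 X]
    {D : Type u} [Preorder D] (n : ℕ) (x : List D → X) : Prop :=
  ∀ t : List D, t.length < n →
    Tendsto (fun u : D => toWeakSpace 𝕜 X (x (t ++ [u]))) atTop (𝓝 0)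

/-- `r_K(x) = max_{x^* ∈ K} Re x^*(x)`; this is `0` for empty `K`. -/
noncomputable def supportFun (K : Set (StrongDual 𝕜 X)) (x : X) : ℝ :=
  ⨆ f : K, RCLike.re ((f : StrongDual 𝕜 X) x)

/-- `s` is an upper bound for `inf_{t ∈ D^n} r_K(∑_{i=1}^n x_{t|_i})`, for every (non-empty) directed
set `D` and every weakly null collection `(x_t)_{t ∈ D^{≤ n}}` in the unit ball of `X`.
The directed sets range over the universe of `X`, where the weak neighbourhood bases
at `0` in `X` live. -/
def IsTreeBound (K : Set (StrongDual 𝕜 X)) (n : ℕ) (s : ℝ) : Prop :=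
  ∀ (D : Type u) [Preorder D] [IsDirectedOrder D] [Nonempty D] (x : List D → X),
    IsWeaklyNull 𝕜 n x →
    (∀ t : List D, 1 ≤ t.length → t.length ≤ n → ‖x t‖ ≤ 1) →
    (⨅ t : {t : List D // t.length = n},
      supportFun K (∑ i : Fin n, x (t.1.take ((i : ℕ) + 1)))) ≤ s

/-- `Σ_n(K)`: the infimum of the real `s > 0` which are bounds as above. -/
noncomputable def sigmaN (K : Set (StrongDual 𝕜 X)) (n : ℕ) : ℝ≥0∞ :=
  ⨅ (s : ℝ) (_ : 0 < s) (_ : IsTreeBound K n s), ENNReal.ofReal s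

/-- `Σ(K) = sup_{n ≥ 1} Σ_n(K)`, with values in `[0, ∞]`. -/
noncomputable def sigma (K : Set (StrongDual 𝕜 X)) : ℝ≥0∞ :=
  ⨆ (n : ℕ) (_ : 1 ≤ n), sigmaN K n

open Classical in
/-- The derivation `s_ε(K)`: the points `x^*` of `K` all of whose weak-star neighbourhoods `V`
satisfy `diam (V ∩ K) > ε` (norm diameter); by convention `s_ε(K) = K` if `ε ≤ 0`. -/
noncomputable def szlenkDeriv (ε : ℝ) (K : Set (StrongDual 𝕜 X)) : Set (StrongDual 𝕜 X) :=
  if ε ≤ 0 then K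
  else {f | f ∈ K ∧ ∀ V ∈ 𝓝 (StrongDual.toWeakDual f),
    ENNReal.ofReal ε < Metric.ediam ((StrongDual.toWeakDual ⁻¹' V) ∩ K)}

/-- `K` has `M`-summable Szlenk index: `∑ ε_i ≤ M` whenever `s_{ε_1} … s_{ε_n}(K) ≠ ∅`. -/
def HasSummableSzlenkWith (K : Set (StrongDual 𝕜 X)) (M : ℝ) : Prop :=
  ∀ l : List ℝ, (l.foldr szlenkDeriv K).Nonempty → l.sum ≤ M

/-- `K` has summable Szlenk index. -/
def HasSummableSzlenk (K : Set (StrongDual 𝕜 X)) : Prop :=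
  ∃ M : ℝ, 0 ≤ M ∧ HasSummableSzlenkWith K M

end Trees

section Operators

variable {𝕜 : Type*} [RCLike 𝕜] {X : Type u} [NormedAddCommGroup X] [NormedSpace 𝕜 X]
  {Y : Type v} [NormedAddCommGroup Y] [NormedSpace 𝕜 Y]

/-- The set `A^* B_{Y^*}`, where `A^* f = f ∘ A`. -/
def adjointBall (A : X →L[𝕜] Y) : Set (StrongDual 𝕜 X) :=
  (fun f : StrongDual 𝕜 Y => f.comp A) '' Metric.closedBall 0 1

/-- `Σ(A) = Σ(A^* B_{Y^*})`. -/
noncomputable def opSigma (A : X →L[𝕜] Y) : ℝ≥0∞ :=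
  sigma (adjointBall A)

/-- The operator `A` has summable Szlenk index. -/
def OpHasSummableSzlenk (A : X →L[𝕜] Y) : Prop :=
  HasSummableSzlenk (adjointBall A)

end Operators

section Spaces

variable (𝕜 : Type*) [RCLike 𝕜] (X : Type u) [NormedAddCommGroup X] [NormedSpace 𝕜 X]

/-- `p` belongs to `{X}_n`: it is a norm on `𝕜^n` such that for every `b > 1` there is a weakly null
collection `(x_t)_{t ∈ D^{≤ n}}` in the unit sphere of `X`, for some directed set `D`, all of whose
branches are `b`-equivalent to the canonical basis of `(𝕜^n, p)`.
The norm of `Fin n → 𝕜` itself is the `ℓ_∞` norm. -/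
def IsAsymptoticNorm (n : ℕ) (p : Seminorm 𝕜 (Fin n → 𝕜)) : Prop :=
  (∀ a, p a = 0 → a = 0) ∧
  ∀ b : ℝ, 1 < b →
    ∃ (D : Type u) (_ : Preorder D) (_ : IsDirectedOrder D) (_ : Nonempty D) (x : List D → X),
      IsWeaklyNull 𝕜 n x ∧
      (∀ t : List D, 1 ≤ t.length → t.length ≤ n → ‖x t‖ = 1) ∧
      ∀ a : Fin n → 𝕜, ‖a‖ = 1 → ∀ t : List D, t.length = n →
        b⁻¹ * ‖∑ i : Fin n, a i • x (t.take ((i : ℕ) + 1))‖ ≤ p a ∧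
        p a ≤ b * ‖∑ i : Fin n, a i • x (t.take ((i : ℕ) + 1))‖

/-- `X` is Asymptotic `c_0`: it is infinite dimensional and the members of all `{X}_n` are uniformly
equivalent to the `ℓ_∞^n` norm. -/
def IsAsymptoticC0 : Prop :=
  ¬ FiniteDimensional 𝕜 X ∧
  ∃ C : ℝ, 1 ≤ C ∧ ∀ n : ℕ, 1 ≤ n → ∀ p : Seminorm 𝕜 (Fin n → 𝕜), IsAsymptoticNorm 𝕜 X n p →
    ∀ a : Fin n → 𝕜, C⁻¹ * ‖a‖ ≤ p a ∧ p a ≤ C * ‖a‖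

end Spaces

section FDD

variable {𝕜 : Type*} [RCLike 𝕜] {X : Type u} [NormedAddCommGroup X] [NormedSpace 𝕜 X]

/-- Finite dimensional decompositions of `X`; the spaces are numbered from `0`, so that `E j`
is the space usually called `E_{j+1}`. -/
def IsFDD (E : ℕ → Submodule 𝕜 X) : Prop :=
  (∀ j, FiniteDimensional 𝕜 (E j)) ∧
  ∀ x : X, ∃! y : ℕ → X, (∀ j, y j ∈ E j) ∧
    Tendsto (fun N => ∑ j ∈ Finset.range N, y j) atTop (𝓝 x)

/-- The projection `P_m` onto the first `m` spaces of an FDD. -/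
noncomputable def fddProj {E : ℕ → Submodule 𝕜 X} (hE : IsFDD E) (m : ℕ) (x : X) : X :=
  ∑ j ∈ Finset.range m, (hE.2 x).choose j

/-- An FDD is shrinking if the union over `m` of the ranges of the adjoints `P_m^*`
is norm dense in `X^*`. -/
def IsShrinking {E : ℕ → Submodule 𝕜 X} (hE : IsFDD E) : Prop :=
  Dense {g : StrongDual 𝕜 X | ∃ (m : ℕ) (f : StrongDual 𝕜 X), ∀ x, g x = f (fddProj hE m x)}

/-- `F` is a blocking of `E`: for some `0 = m_0 < m_1 < …`, the `j`-th space of `F` is the sum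
of the `E i`, `m_j ≤ i < m_{j+1}` (numbering from `0`). -/
def IsBlocking (F E : ℕ → Submodule 𝕜 X) : Prop :=
  ∃ m : ℕ → ℕ, m 0 = 0 ∧ StrictMono m ∧ ∀ j, F j = ⨆ i ∈ Finset.Ico (m j) (m (j + 1)), E i

/-- `E` is asymptotic `c_0` in `X`.  As the spaces are numbered from `0`, the usual condition
`n ≤ k_0` becomes `n ≤ k_0 + 1`.  The norm `‖x‖` of `x : Fin n → X` is `max_i ‖x i‖`. -/
def IsAsymptoticC0In (E : ℕ → Submodule 𝕜 X) : Prop :=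
  ∃ C : ℝ, 1 ≤ C ∧ ∀ n : ℕ, 1 ≤ n → ∀ k : Fin (n + 1) → ℕ, StrictMono k → n ≤ k 0 + 1 →
    ∀ x : Fin n → X, (∀ i, x i ∈ ⨆ j ∈ Finset.Ico (k i.castSucc) (k i.succ), E j) →
      C⁻¹ * ‖x‖ ≤ ‖∑ i, x i‖ ∧ ‖∑ i, x i‖ ≤ C * ‖x‖

end FDD

end SummableSzlenk

/-!
Both directions of all equivalences pass through one filter. Let `weakNhdsZero` be the filter of
weak neighbourhoods of `0` in `X`, and let `seqFilter S n` be the filter on `X^n` for which an event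
is large if it holds for all `z 0 ∈ S` weakly close to zero, all `z 1 ∈ S` weakly close to zero (how
close may depend on `z 0`), and so on. An event is large if and only if it occurs along some branch
of every weakly null tree in `S` (`IsWeaklyNull.exists_branch`, `exists_weaklyNull_tree`). As
`r_K(x) = ‖A x‖` for `K = A^* B_{Y^*}`, the condition `Σ(A) < ∞` says that, for some `c` and all
`n`, the event `‖A (∑ z i)‖ ≤ c` is large for `S = B_X` (`opSigma_lt_top_iff`).

*Szlenk index.* If `f ∈ s_ε(K)`, then there are `g ∈ K` weak-star close to `f` and `x ∈ B_X` weakly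
close to zero with `Re g(x) ≥ ε / 5`, because the ball is totally bounded for the weak uniformity.
Iteration bounds `∑ ε_i` by `5 c`. Conversely, if `K` is weak-star compact and the event
`sup_{g ∈ K} Re g(∑ z i) ≤ c` is not large, then limits along ultrafilters of functionals in `K` lie
in iterated derivations of `K` with `∑ ε_i` close to `c` (`exists_mem_foldr_szlenkDeriv`).

*Asymptotic norms.* Weakly null sequences of unit vectors dominate half of the `ℓ_∞` norm, so that
only upper bounds matter, and these are given by `Σ(I_X) < ∞`. Conversely, if the event
`‖∑ z i‖ ≤ c` is not large for `S = S_X`, then the limit of `‖∑ a_i z_i‖` along an ultrafilter is an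
asymptotic norm which is at least `c` at `(1, …, 1)` (`exists_isAsymptoticNorm`). It remains to
replace the sphere by the ball: the sets defined by upper bounds are convex, and in an infinite
dimensional space a vector of the ball which is weakly close to zero is a convex combination of two
such unit vectors (`eventually_norm_add_sum_le_closedBall`).

*Blockings.* The projections of a finite dimensional decomposition are uniformly bounded by the open
mapping theorem. Weakly null sequences are small perturbations of block sequences, which gives
`Σ(I_X) < ∞` if some blocking is asymptotic `c_0`. Conversely, vectors of the ball supported far out
with respect to a shrinking decomposition are weakly close to zero; by compactness of the balls of
finite dimensional spaces, a blocking can be chosen recursively such that sums of few far out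
blocks separated by gaps are bounded by `c + 1` (`norm_sum_le_of_gaps`). Splitting into blocks with
odd and even number removes the gaps.
-/

namespace SummableSzlenk

/-! ### The filter of weakly null sequences of length `n` -/

section SeqFilter

variable (𝕜 : Type*) [RCLike 𝕜] {X : Type u} [NormedAddCommGroup X] [NormedSpace 𝕜 X]

/-- The weak neighbourhoods of `0`, as a filter on `X` itself. -/
noncomputable def weakNhdsZero (𝕜 : Type*) [RCLike 𝕜] (X : Type u) [NormedAddCommGroup X]
    [NormedSpace 𝕜 X] : Filter X :=
  comap (toWeakSpace 𝕜 X) (𝓝 0)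

/-- The filter on `X^n` for which `∀ᶠ z, Q z` means: for all `z 0 ∈ S` weakly close to zero, for all
`z 1 ∈ S` weakly close to zero (depending on `z 0`), and so on, `Q z` holds. -/
noncomputable def seqFilter (S : Set X) : (n : ℕ) → Filter (Fin n → X)
  | 0 => pure 0
  | n + 1 => (weakNhdsZero 𝕜 X ⊓ 𝓟 S).bind fun y => (seqFilter S n).map (Matrix.vecCons y)

variable {𝕜}

lemma tendsto_toWeakSpace_zero_iff {α : Type*} {l : Filter α} {f : α → X} :
    Tendsto (fun a => toWeakSpace 𝕜 X (f a)) l (𝓝 0) ↔ Tendsto f l (weakNhdsZero 𝕜 X) := by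
  rw [weakNhdsZero, tendsto_comap_iff]; rfl

lemma mem_weakNhdsZero_iff {U : Set X} : U ∈ weakNhdsZero 𝕜 X ↔
    ∃ s : Set (StrongDual 𝕜 X), s.Finite ∧ ∃ r : ℝ, 0 < r ∧ {x | ∀ f ∈ s, ‖f x‖ < r} ⊆ U := by
  have h0 : weakNhdsZero 𝕜 X = comap (fun (x : X) (f : StrongDual 𝕜 X) => f x) (𝓝 0) := by
    have := nhds_induced (T := Pi.topologicalSpace)
      (fun (x : WeakSpace 𝕜 X) (f : StrongDual 𝕜 X) => (topDualPairing 𝕜 X).flip x f) 0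
    have h2 : (𝓝 (0 : WeakSpace 𝕜 X)) =
      comap (fun (x : WeakSpace 𝕜 X) (f : StrongDual 𝕜 X) => (topDualPairing 𝕜 X).flip x f) 
        (𝓝 0) := by
      refine this.trans ?_
      congr 2
      funext f
      exact map_zero (topDualPairing 𝕜 X f)
    rw [weakNhdsZero, h2, comap_comap]
    rfl
  rw [h0, mem_comap]
  constructor
  · rintro ⟨t, ht, htU⟩
    rw [nhds_pi, Filter.mem_pi] at ht
    obtain ⟨I, hI, V, hV, hVt⟩ := ht
    choose r hr hrV using fun f => Metric.mem_nhds_iff.1 (hV f)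
    obtain ⟨ρ, hρ, hρr⟩ : ∃ ρ > 0, ∀ f ∈ I, ρ ≤ r f := by
      clear hVt
      induction I, hI using Set.Finite.induction_on with
      | empty => exact ⟨1, one_pos, by simp⟩
      | insert _ _ ih =>
        obtain ⟨ρ, hρ, h⟩ := ih
        rename_i a s _ _
        refine ⟨min ρ (r a), lt_min hρ (hr a), ?_⟩
        rintro f (rfl | hf)
        · exact min_le_right _ _
        · exact (min_le_left _ _).trans (h f hf)
    refine ⟨I, hI, ρ, hρ, fun x hx => htU (hVt ?_)⟩
    intro f hf
    exact hrV f (by simpa using (hx f hf).trans_le (hρr f hf))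
  · rintro ⟨s, hs, r, hr, h⟩
    refine ⟨s.pi fun _ => Metric.ball 0 r, set_pi_mem_nhds hs fun f _ => Metric.ball_mem_nhds _ hr,
      ?_⟩
    intro x hx
    exact h fun f hf => by simpa using hx f hf

lemma tendsto_weakNhdsZero (f : StrongDual 𝕜 X) : Tendsto f (weakNhdsZero 𝕜 X) (𝓝 0) := by
  rw [Metric.tendsto_nhds]
  intro ε hε
  exact mem_weakNhdsZero_iff.2 ⟨{f}, Set.finite_singleton f, ε, hε, fun x hx => by
    simpa using hx f rfl⟩

lemma tendsto_smul_weakNhdsZero (c : 𝕜) :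
    Tendsto (fun x : X => c • x) (weakNhdsZero 𝕜 X) (weakNhdsZero 𝕜 X) := by
  intro U hU
  obtain ⟨s, hs, r, hr, h⟩ := mem_weakNhdsZero_iff.1 hU
  refine mem_weakNhdsZero_iff.2 ⟨s, hs, r / (‖c‖ + 1), by positivity, fun x hx => h ?_⟩
  intro f hf
  have := hx f hf
  rw [lt_div_iff₀ (by positivity)] at this
  rw [map_smul, norm_smul]
  nlinarith [norm_nonneg (f x), norm_nonneg c]

lemma pure_zero_le_weakNhdsZero : pure 0 ≤ weakNhdsZero 𝕜 X := by
  intro U hU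
  obtain ⟨s, hs, r, hr, h⟩ := mem_weakNhdsZero_iff.1 hU
  exact h fun f _ => by simpa using hr

lemma eventually_seqFilter_zero {S : Set X} {Q : (Fin 0 → X) → Prop} :
    (∀ᶠ z in seqFilter 𝕜 S 0, Q z) ↔ Q 0 := by
  simp [seqFilter]

lemma eventually_seqFilter_succ {S : Set X} {n : ℕ} {Q : (Fin (n + 1) → X) → Prop} :
    (∀ᶠ z in seqFilter 𝕜 S (n + 1), Q z) ↔
      ∀ᶠ y in weakNhdsZero 𝕜 X ⊓ 𝓟 S, ∀ᶠ z in seqFilter 𝕜 S n, Q (Matrix.vecCons y z) := by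
  simp only [seqFilter, eventually_bind, eventually_map]

lemma frequently_seqFilter_zero {S : Set X} {Q : (Fin 0 → X) → Prop} :
    (∃ᶠ z in seqFilter 𝕜 S 0, Q z) ↔ Q 0 := by
  simp [seqFilter, Filter.Frequently]

lemma frequently_seqFilter_succ {S : Set X} {n : ℕ} {Q : (Fin (n + 1) → X) → Prop} :
    (∃ᶠ z in seqFilter 𝕜 S (n + 1), Q z) ↔
      ∃ᶠ y in weakNhdsZero 𝕜 X ⊓ 𝓟 S, ∃ᶠ z in seqFilter 𝕜 S n, Q (Matrix.vecCons y z) := by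
  simp only [Filter.Frequently, eventually_seqFilter_succ, not_not]

lemma eventually_seqFilter_mem (S : Set X) (n : ℕ) :
    ∀ᶠ z in seqFilter 𝕜 S n, ∀ i, z i ∈ S := by
  induction n with
  | zero => simp
  | succ n ih =>
    rw [eventually_seqFilter_succ, eventually_inf_principal]
    refine Eventually.of_forall fun y hy => ih.mono fun z hz => ?_
    intro i
    refine Fin.cases ?_ (fun i => ?_) i
    · simpa using hy
    · simpa using hz i

lemma pure_zero_le_seqFilter {S : Set X} (hS : 0 ∈ S) (n : ℕ) : pure 0 ≤ seqFilter 𝕜 S n := by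
  induction n with
  | zero => exact le_refl (pure 0)
  | succ n ih =>
    intro Q hQ
    have h := eventually_seqFilter_succ.1 hQ
    rw [eventually_inf_principal] at h
    have h1 : ∀ᶠ z in seqFilter 𝕜 S n, Matrix.vecCons 0 z ∈ Q :=
      pure_zero_le_weakNhdsZero (𝕜 := 𝕜) h hS
    have h2 : Matrix.vecCons (0 : X) 0 ∈ Q := ih h1
    simpa using h2

/-- If `a i • S ⊆ B` for all `i`, then `(z i)` can be replaced by `(a i • z i)` in properties that
hold eventually for weakly null sequences in `B`. -/
lemma tendsto_smul_seqFilter {S B : Set X} {n : ℕ} (a : Fin n → 𝕜)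
    (h : ∀ i, ∀ x ∈ S, a i • x ∈ B) :
    Tendsto (fun z i => a i • z i) (seqFilter 𝕜 S n) (seqFilter 𝕜 B n) := by
  induction n with
  | zero =>
    exact tendsto_pure.2 (Eventually.of_forall fun z => Subsingleton.elim _ _)
  | succ n ih =>
    intro Q hQ
    have h1 := eventually_seqFilter_succ.1 hQ
    refine eventually_seqFilter_succ.2 ?_
    have h2 : Tendsto (fun x : X => a 0 • x) (weakNhdsZero 𝕜 X ⊓ 𝓟 S) (weakNhdsZero 𝕜 X ⊓ 𝓟 B) :=
      (tendsto_smul_weakNhdsZero (a 0)).inf (tendsto_principal_principal.2 (h 0))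
    refine (h2.eventually h1).mono fun y hy => ?_
    refine ((ih (fun i => a i.succ) fun i => h i.succ).eventually hy).mono fun z hz => ?_
    have h3 : (fun i => a i • Matrix.vecCons y z i) =
        Matrix.vecCons (a 0 • y) fun i => a i.succ • z i := by
      funext i
      refine Fin.cases ?_ (fun i => ?_) i <;> simp
    change (fun i => a i • Matrix.vecCons y z i) ∈ Q
    rw [h3]
    exact hz

end SeqFilter

/-! ### Weakly null trees -/

section TreeFilter

/-- The vectors `x_{t|_1}, …, x_{t|_n}` along the branch `t` of a tree. -/
def branch {D X : Type*} (x : List D → X) (n : ℕ) (t : List D) : Fin n → X :=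
  fun i => x (t.take ((i : ℕ) + 1))

lemma branch_cons {D X : Type*} (x : List D → X) (n : ℕ) (d : D) (t : List D) :
    branch x (n + 1) (d :: t) = Matrix.vecCons (x [d]) (branch (fun s => x (d :: s)) n t) := by
  funext i
  refine Fin.cases ?_ (fun i => ?_) i <;> simp [branch]

/-- The tree with first vectors `y d` and subtrees `x d`. The value at the empty sequence is
irrelevant. -/
def joinTrees {D X : Type*} [Zero X] (y : D → X) (x : D → List D → X) : List D → X
  | [] => 0
  | [d] => y d
  | d :: e :: t => x d (e :: t)

lemma joinTrees_cons {D X : Type*} [Zero X] (y : D → X) (x : D → List D → X) (d : D) {t : List D}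
    (ht : t ≠ []) : joinTrees y x (d :: t) = x d t := by
  cases t with
  | nil => exact absurd rfl ht
  | cons e t => rfl

variable {𝕜 : Type*} [RCLike 𝕜] {X : Type u} [NormedAddCommGroup X] [NormedSpace 𝕜 X]

/-- A property that holds eventually for `seqFilter` holds along some branch of every weakly null
tree. -/
lemma IsWeaklyNull.exists_branch {D : Type u} [Preorder D] [IsDirectedOrder D] [Nonempty D]
    {S : Set X} {n : ℕ} {x : List D → X} (hx : IsWeaklyNull 𝕜 n x)
    (hS : ∀ t : List D, 1 ≤ t.length → t.length ≤ n → x t ∈ S) {Q : (Fin n → X) → Prop}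
    (hQ : ∀ᶠ z in seqFilter 𝕜 S n, Q z) : ∃ t : List D, t.length = n ∧ Q (branch x n t) := by
  induction n generalizing x with
  | zero =>
    refine ⟨[], rfl, ?_⟩
    convert eventually_seqFilter_zero.1 hQ
  | succ n ih =>
    have h1 := eventually_seqFilter_succ.1 hQ
    have h2 : Tendsto (fun d : D => x [d]) atTop (weakNhdsZero 𝕜 X ⊓ 𝓟 S) := by
      rw [tendsto_inf]
      exact ⟨tendsto_toWeakSpace_zero_iff.1 (hx [] (by simp)),
        tendsto_principal.2 <| Eventually.of_forall fun d => hS [d] (by simp) (by simp)⟩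
    obtain ⟨d, hd⟩ := (h2.eventually h1).exists
    obtain ⟨t, ht, hQt⟩ := ih (x := fun s => x (d :: s))
      (fun t ht => hx (d :: t) (by simpa using ht))
      (fun t _ h => hS (d :: t) (by simp) (by simpa using h)) hd
    exact ⟨d :: t, by simpa using ht, by rwa [branch_cons]⟩

/-- The weak neighbourhoods of zero ordered by reverse inclusion. -/
abbrev WeakNhdIndex (𝕜 : Type*) [RCLike 𝕜] (X : Type u) [NormedAddCommGroup X]
    [NormedSpace 𝕜 X] : Type u :=
  {U : Set X // U ∈ weakNhdsZero 𝕜 X}ᵒᵈ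

instance : IsDirectedOrder (WeakNhdIndex 𝕜 X) :=
  ⟨fun U V => ⟨OrderDual.toDual ⟨(OrderDual.ofDual U).1 ∩ (OrderDual.ofDual V).1,
    inter_mem (OrderDual.ofDual U).2 (OrderDual.ofDual V).2⟩,
    Set.inter_subset_left, Set.inter_subset_right⟩⟩

instance : Nonempty (WeakNhdIndex 𝕜 X) := ⟨OrderDual.toDual ⟨Set.univ, univ_mem⟩⟩

/-- A property that holds frequently for `seqFilter` holds along all branches of some weakly null
tree. -/
lemma exists_weaklyNull_tree {S : Set X} {n : ℕ} {Q : (Fin n → X) → Prop}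
    (hQ : ∃ᶠ z in seqFilter 𝕜 S n, Q z) :
    ∃ x : List (WeakNhdIndex 𝕜 X) → X, IsWeaklyNull 𝕜 n x ∧
      (∀ t : List (WeakNhdIndex 𝕜 X), 1 ≤ t.length → t.length ≤ n → x t ∈ S) ∧
      ∀ t : List (WeakNhdIndex 𝕜 X), t.length = n → Q (branch x n t) := by
  induction n with
  | zero =>
    refine ⟨fun _ => 0, fun t ht => absurd ht (by simp), fun t h1 h2 => absurd h1 (by omega),
      fun t _ => ?_⟩
    convert frequently_seqFilter_zero.1 hQ
  | succ n ih =>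
    have h1 := frequently_seqFilter_succ.1 hQ
    have h2 : ∀ d : WeakNhdIndex 𝕜 X, ∃ y, y ∈ (OrderDual.ofDual d).1 ∧ y ∈ S ∧
        ∃ᶠ z in seqFilter 𝕜 S n, Q (Matrix.vecCons y z) := by
      intro d
      obtain ⟨y, hy, hyd⟩ := (h1.and_eventually
        (inter_mem (mem_inf_of_left (OrderDual.ofDual d).2) (mem_inf_of_right
          (mem_principal_self S)))).exists
      exact ⟨y, hyd.1, hyd.2, hy⟩
    choose y hyd hyS hyQ using h2
    choose x hx hxS hxQ using fun d => ih (hyQ d)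
    refine ⟨joinTrees y x, ?_, ?_, ?_⟩
    · intro t ht
      cases t with
      | nil =>
        rw [tendsto_toWeakSpace_zero_iff]
        intro U hU
        exact (eventually_ge_atTop (OrderDual.toDual ⟨U, hU⟩ : WeakNhdIndex 𝕜 X)).mono
          fun d hd => hd (hyd d)
      | cons d t =>
        have := hx d t (by simpa using ht)
        simpa only [List.cons_append, joinTrees_cons y x d (List.append_ne_nil_of_right_ne_nil t
          (List.cons_ne_nil _ _))] using this
    · intro t h1 h2
      cases t with
      | nil => simp at h1
      | cons d t =>
        cases t with
        | nil => exact hyS d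
        | cons e t => exact hxS d (e :: t) (by simp) (by simpa using h2)
    · intro t ht
      cases t with
      | nil => simp at ht
      | cons d t =>
        have h3 := hxQ d t (by simpa using ht)
        rw [branch_cons]
        have h4 : branch (fun s => joinTrees y x (d :: s)) n t = branch (x d) n t := by
          funext i
          refine joinTrees_cons y x d fun h => ?_
          have h4 := congrArg List.length h
          have h5 : t.length = n := by simpa using ht
          have := i.2
          simp only [List.length_take, List.length_nil] at h4
          omega
        rw [h4]
        exact h3

end TreeFilter

/-! ### Operators and the Szlenk derivation -/

section Szlenk

variable {𝕜 : Type*} [RCLike 𝕜] {X : Type u} [NormedAddCommGroup X] [NormedSpace 𝕜 X]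
  {Y : Type v} [NormedAddCommGroup Y] [NormedSpace 𝕜 Y]

lemma re_le_of_mem_adjointBall {A : X →L[𝕜] Y} {f : StrongDual 𝕜 X} (hf : f ∈ adjointBall A)
    (x : X) : RCLike.re (f x) ≤ ‖A x‖ := by
  obtain ⟨g, hg, rfl⟩ := hf
  refine (RCLike.re_le_norm _).trans ((g.le_opNorm (A x)).trans ?_)
  exact mul_le_of_le_one_left (norm_nonneg _) (by simpa using hg)

lemma exists_mem_adjointBall_re_eq (A : X →L[𝕜] Y) (x : X) :
    ∃ f ∈ adjointBall A, RCLike.re (f x) = ‖A x‖ := by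
  obtain ⟨g, hg, hgx⟩ := exists_dual_vector'' 𝕜 (A x)
  exact ⟨g.comp A, ⟨g, by simpa using hg, rfl⟩, by simp [hgx]⟩

lemma supportFun_adjointBall (A : X →L[𝕜] Y) (x : X) : supportFun (adjointBall A) x = ‖A x‖ := by
  obtain ⟨f, hf, hfx⟩ := exists_mem_adjointBall_re_eq A x
  have hb : ∀ g : adjointBall A, RCLike.re ((g : StrongDual 𝕜 X) x) ≤ ‖A x‖ :=
    fun g => re_le_of_mem_adjointBall g.2 x
  have : Nonempty (adjointBall A) := ⟨⟨f, hf⟩⟩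
  refine le_antisymm (ciSup_le hb) ?_
  rw [← hfx]
  exact le_ciSup (f := fun g : adjointBall A => RCLike.re ((g : StrongDual 𝕜 X) x))
    ⟨_, Set.forall_mem_range.2 hb⟩ ⟨f, hf⟩

/-- Finiteness of `Σ(A)` in terms of the filters `seqFilter`. -/
lemma opSigma_lt_top_iff (A : X →L[𝕜] Y) : opSigma A < ⊤ ↔
    ∃ c : ℝ, ∀ n, ∀ᶠ z in seqFilter 𝕜 (Metric.closedBall (0 : X) 1) n, ‖A (∑ i, z i)‖ ≤ c := by
  constructor
  · intro h
    set σ := opSigma A with hσ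
    refine ⟨(σ + 1).toReal, fun n => ?_⟩
    rcases Nat.eq_zero_or_pos n with rfl | hn
    · simp
    have h1 : sigmaN (adjointBall A) n < σ + 1 := by
      refine lt_of_le_of_lt ?_ (ENNReal.lt_add_right h.ne one_ne_zero)
      exact le_iSup₂ (f := fun (n : ℕ) (_ : 1 ≤ n) => sigmaN (adjointBall A) n) n hn
    simp only [sigmaN, iInf_lt_iff] at h1
    obtain ⟨s, hs, hsb, hlt⟩ := h1
    have hsc : s < (σ + 1).toReal := by
      rwa [← ENNReal.ofReal_lt_iff_lt_toReal hs.le (by simp [h.ne])]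
    by_contra hcon
    obtain ⟨x, hx, hxS, hxQ⟩ := exists_weaklyNull_tree (not_eventually.1 hcon)
    have h2 := hsb (WeakNhdIndex 𝕜 X) x hx fun t h1 h2 => by simpa using hxS t h1 h2
    have : Nonempty {t : List (WeakNhdIndex 𝕜 X) // t.length = n} :=
      ⟨⟨List.replicate n (Classical.arbitrary _), by simp⟩⟩
    refine absurd (h2.trans_lt hsc) (not_lt.2 (le_ciInf fun t => ?_))
    rw [supportFun_adjointBall]
    exact (not_le.1 (hxQ t.1 t.2)).le
  · rintro ⟨c, hc⟩
    refine lt_of_le_of_lt (iSup₂_le fun n hn => ?_) (ENNReal.ofReal_lt_top (r := max c 1))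
    refine iInf₂_le_of_le (max c 1) (lt_max_of_lt_right one_pos) (iInf_le_of_le ?_ le_rfl)
    intro D _ _ _ x hx hxS
    obtain ⟨t, ht, hQ⟩ := hx.exists_branch (fun t h1 h2 => by simpa using hxS t h1 h2) (hc n)
    refine (ciInf_le ⟨0, ?_⟩ (⟨t, ht⟩ : {t : List D // t.length = n})).trans ?_
    · rintro _ ⟨t, rfl⟩
      simp only [supportFun_adjointBall]
      exact norm_nonneg _
    · rw [supportFun_adjointBall]
      exact hQ.trans (le_max_left _ _)

/-- The unit ball is totally bounded for the weak uniformity. -/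
lemma exists_finite_cover_weakNhdsZero {U : Set X} (hU : U ∈ weakNhdsZero 𝕜 X) :
    ∃ t : Set X, t.Finite ∧ ∀ x : X, ‖x‖ ≤ 1 → ∃ y ∈ t, ‖y‖ ≤ 1 ∧ x - y ∈ U := by
  obtain ⟨s, hs, r, hr, h⟩ := mem_weakNhdsZero_iff.1 hU
  have := hs.fintype
  let T : X →L[𝕜] (s → 𝕜) := ContinuousLinearMap.pi fun f : s => (f : StrongDual 𝕜 X)
  have hb : TotallyBounded (T '' Metric.closedBall 0 1) :=
    (T.lipschitz.isBounded_image
      Metric.isBounded_closedBall).isCompact_closure.totallyBounded.subset subset_closure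
  obtain ⟨t, htT, ht, hcov⟩ := Metric.finite_approx_of_totallyBounded hb r hr
  obtain ⟨t', ht', htfin, rfl⟩ := Set.exists_subset_image_finite_and.1 ⟨t, htT, ht, rfl⟩
  refine ⟨t', htfin, fun x hx => ?_⟩
  have := hcov ⟨x, by simpa using hx, rfl⟩
  simp only [Set.mem_iUnion, Metric.mem_ball] at this
  obtain ⟨_, ⟨y, hy, rfl⟩, hxy⟩ := this
  refine ⟨y, hy, by simpa using ht' hy, h fun f hf => ?_⟩
  have h2 : dist (T x ⟨f, hf⟩) (T y ⟨f, hf⟩) ≤ dist (T x) (T y) := dist_le_pi_dist _ _ _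
  rw [map_sub, ← dist_eq_norm]
  exact h2.trans_lt hxy

lemma norm_le_of_forall_re_le {f : StrongDual 𝕜 X} {c : ℝ} (hc : 0 ≤ c)
    (h : ∀ x, ‖x‖ ≤ 1 → RCLike.re (f x) ≤ c) : ‖f‖ ≤ c := by
  refine ContinuousLinearMap.opNorm_le_of_unit_norm hc fun x hx => ?_
  obtain ⟨w, hw, hwx⟩ := RCLike.exists_norm_eq_mul_self (f x)
  have h1 := h (w • x) (by rw [norm_smul, hw, hx, one_mul])
  rwa [map_smul, smul_eq_mul, ← hwx, RCLike.ofReal_re] at h1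

/-- A point of `s_ε(K)` is approximated by points of `K` which are large on weakly small vectors. -/
lemma exists_re_ge_of_mem_szlenkDeriv {ε : ℝ} {K : Set (StrongDual 𝕜 X)} {f : StrongDual 𝕜 X}
    (hf : f ∈ szlenkDeriv ε K) {V : Set (WeakDual 𝕜 X)} (hV : V ∈ 𝓝 (StrongDual.toWeakDual f))
    {U : Set X} (hU : U ∈ weakNhdsZero 𝕜 X) :
    ∃ g ∈ K, StrongDual.toWeakDual g ∈ V ∧ ∃ x ∈ U, ‖x‖ ≤ 1 ∧ ε / 5 ≤ RCLike.re (g x) := by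
  rw [szlenkDeriv] at hf
  split_ifs at hf with hε
  · exact ⟨f, hf, mem_of_mem_nhds hV, 0, pure_zero_le_weakNhdsZero hU, by simp, by simp; linarith⟩
  push Not at hε
  by_contra! hcon
  -- The halves of the differences of two vectors of the ball in the same piece of a finite
  -- cover lie in `U`, as do their negatives.
  have hU' : {x : X | (2⁻¹ : 𝕜) • x ∈ U ∧ (-2⁻¹ : 𝕜) • x ∈ U} ∈ weakNhdsZero 𝕜 X :=
    inter_mem (tendsto_smul_weakNhdsZero _ hU) (tendsto_smul_weakNhdsZero _ hU)
  obtain ⟨t, ht, hcov⟩ := exists_finite_cover_weakNhdsZero hU'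
  have hV' : {g : WeakDual 𝕜 X | g ∈ V ∧ ∀ y ∈ t, ‖g y - f y‖ < ε / 20} ∈
      𝓝 (StrongDual.toWeakDual f) := by
    refine inter_mem hV ((eventually_all_finite ht).2 fun y _ => ?_)
    have h1 : Tendsto (fun g : WeakDual 𝕜 X => ‖g y - f y‖) (𝓝 (StrongDual.toWeakDual f))
        (𝓝 ‖f y - f y‖) :=
      (((WeakDual.eval_continuous y).tendsto _).sub_const _).norm
    exact h1.eventually (gt_mem_nhds (by simp; linarith))
  refine absurd (hf.2 _ hV') (not_lt.2 (Metric.ediam_le fun g hg g' hg' => ?_))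
  rw [edist_dist, dist_eq_norm]
  refine ENNReal.ofReal_le_ofReal (norm_le_of_forall_re_le hε.le fun x hx => ?_)
  obtain ⟨⟨hgV, hgt⟩, hgK⟩ := hg
  obtain ⟨⟨hgV', hgt'⟩, hgK'⟩ := hg'
  obtain ⟨y, hy, hy1, hyU, hyU'⟩ := hcov x hx
  have hn : ‖x - y‖ ≤ 2 := (norm_sub_le _ _).trans (by linarith)
  have h1 := hcon g hgK hgV _ hyU (by rw [norm_smul]; simp; linarith)
  have h2 := hcon g' hgK' hgV' _ hyU' (by rw [norm_smul]; simp; linarith)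
  have h3 : ‖g y - f y‖ < ε / 20 := hgt y hy
  have h4 : ‖g' y - f y‖ < ε / 20 := hgt' y hy
  have h5 : RCLike.re ((g - g') y) ≤ ε / 10 := by
    refine (RCLike.re_le_norm _).trans ?_
    have : (g - g') y = (g y - f y) - (g' y - f y) := by simp
    rw [this]
    exact (norm_sub_le _ _).trans (by linarith)
  have h6 : RCLike.re (g ((2⁻¹ : 𝕜) • (x - y))) = (RCLike.re (g x) - RCLike.re (g y)) / 2 := by
    rw [map_smul, smul_eq_mul, show (2⁻¹ : 𝕜) = ((2⁻¹ : ℝ) : 𝕜) by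
      rw [RCLike.ofReal_inv, RCLike.ofReal_ofNat], RCLike.re_ofReal_mul,
      map_sub, map_sub]
    ring
  have h7 : RCLike.re (g' ((-2⁻¹ : 𝕜) • (x - y))) = -(RCLike.re (g' x) - RCLike.re (g' y)) / 2 := by
    rw [map_smul, smul_eq_mul, show (-2⁻¹ : 𝕜) = ((-2⁻¹ : ℝ) : 𝕜) by
      rw [RCLike.ofReal_neg, RCLike.ofReal_inv, RCLike.ofReal_ofNat], RCLike.re_ofReal_mul,
      map_sub, map_sub]
    ring
  rw [h6] at h1
  rw [h7] at h2
  simp only [_root_.sub_apply, map_sub] at h5 ⊢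
  linarith

/-- If all functionals of `K` are eventually at most `c` on sums of weakly null sequences in the
ball, then the `ε_i` with `s_{ε_1} … s_{ε_n}(K) ≠ ∅` have sum at most `5 c` (take `v = 0`). -/
lemma re_add_sum_le_of_mem_foldr {K : Set (StrongDual 𝕜 X)} {c : ℝ} (l : List ℝ) :
    ∀ f ∈ l.foldr szlenkDeriv K, ∀ v : X,
    (∀ᶠ z in seqFilter 𝕜 (Metric.closedBall (0 : X) 1) l.length,
      ∀ g ∈ K, RCLike.re (g (v + ∑ i, z i)) ≤ c) → RCLike.re (f v) + l.sum / 5 ≤ c := by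
  induction l with
  | nil =>
    intro f hf v h
    have := eventually_seqFilter_zero.1 h f hf
    simpa using this
  | cons ε l ih =>
    intro f hf v h
    rw [List.length_cons, eventually_seqFilter_succ, eventually_inf_principal] at h
    refine le_of_forall_pos_le_add fun δ hδ => ?_
    have hV : ∀ᶠ g : WeakDual 𝕜 X in 𝓝 (StrongDual.toWeakDual f),
        RCLike.re (f v) - δ < RCLike.re (g v) := by
      have h1 : Tendsto (fun g : WeakDual 𝕜 X => RCLike.re (g v)) (𝓝 (StrongDual.toWeakDual f))
          (𝓝 (RCLike.re (f v))) :=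
        (RCLike.continuous_re.tendsto _).comp ((WeakDual.eval_continuous v).tendsto _)
      exact h1.eventually (lt_mem_nhds (by linarith))
    obtain ⟨g, hg, hgV, x, hx, hx1, hgx⟩ := exists_re_ge_of_mem_szlenkDeriv hf hV h
    have h2 := ih g hg (v + x) ((hx (by simpa using hx1)).mono fun z hz g' hg' => by
      have := hz g' hg'
      simpa [Fin.sum_univ_succ, add_assoc] using this)
    have h3 : RCLike.re (f v) - δ < RCLike.re (g v) := hgV
    simp only [map_add, List.sum_cons] at h2 ⊢
    linarith

lemma isClosed_szlenkDeriv {K : Set (StrongDual 𝕜 X)} (hK : IsClosed (WeakDual.toStrongDual ⁻¹' K))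
    (ε : ℝ) : IsClosed (WeakDual.toStrongDual ⁻¹' szlenkDeriv ε K) := by
  rw [szlenkDeriv]
  split_ifs
  · exact hK
  refine isClosed_of_closure_subset fun f hf => ⟨?_, fun V hV => ?_⟩
  · exact hK.closure_subset_iff.2 (fun g hg => hg.1) hf
  · obtain ⟨W, hWV, hW, hfW⟩ := mem_nhds_iff.1 hV
    obtain ⟨g, hgW, hg⟩ := mem_closure_iff.1 hf W hW hfW
    exact hg.2 V (mem_of_superset (hW.mem_nhds hgW) hWV)

lemma isClosed_foldr_szlenkDeriv {K : Set (StrongDual 𝕜 X)}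
    (hK : IsClosed (WeakDual.toStrongDual ⁻¹' K)) (l : List ℝ) :
    IsClosed (WeakDual.toStrongDual ⁻¹' l.foldr szlenkDeriv K) := by
  induction l with
  | nil => exact hK
  | cons ε l ih => exact isClosed_szlenkDeriv ih ε

lemma foldr_szlenkDeriv_subset (K : Set (StrongDual 𝕜 X)) (l : List ℝ) :
    l.foldr szlenkDeriv K ⊆ K := by
  induction l with
  | nil => exact subset_rfl
  | cons ε l ih =>
    refine fun f hf => ih ?_
    rw [List.foldr_cons, szlenkDeriv] at hf
    split_ifs at hf
    · exact hf
    · exact hf.1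

lemma exists_finite_grid (R : ℝ) {η : ℝ} (hη : 0 < η) :
    ∃ G : Set ℝ, G.Finite ∧ ∀ e ∈ Set.Icc (-R) R, ∃ ε ∈ G, e - η ≤ ε ∧ ε < e := by
  obtain ⟨t, -, ht, hcov⟩ := Metric.finite_approx_of_totallyBounded
    (isCompact_Icc (a := -R) (b := R)).totallyBounded (η / 2) (half_pos hη)
  refine ⟨(fun x => x - η / 2) '' t, ht.image _, fun e he => ?_⟩
  have := hcov he
  simp only [Set.mem_iUnion, Metric.mem_ball, Real.dist_eq, abs_lt] at this
  obtain ⟨y, hy, h1, h2⟩ := this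
  exact ⟨_, ⟨y, hy, rfl⟩, by linarith, by linarith⟩

/-- If functionals of a weak-star compact set `K` are frequently greater than `c` on sums of weakly
null sequences of length `n` in the ball, then some `n`-fold Szlenk derivation with
`∑ ε_i` close to `c` is not empty.  The finite set `L` serves to choose the same `ε_2, …, ε_n` for
many first vectors. -/
lemma exists_mem_foldr_szlenkDeriv {K : Set (StrongDual 𝕜 X)}
    (hK : IsCompact (WeakDual.toStrongDual ⁻¹' K)) {R : ℝ} (hR : ∀ f ∈ K, ‖f‖ ≤ R)
    {η : ℝ} (hη : 0 < η) (n : ℕ) :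
    ∃ L : Set (List ℝ), L.Finite ∧ ∀ (v : X) (c : ℝ),
      (∃ᶠ z in seqFilter 𝕜 (Metric.closedBall (0 : X) 1) n,
        ∃ g ∈ K, c < RCLike.re (g (v + ∑ i, z i))) →
      ∃ l ∈ L, ∃ f ∈ l.foldr szlenkDeriv K, c - n * η ≤ RCLike.re (f v) + l.sum := by
  induction n with
  | zero =>
    refine ⟨{[]}, Set.finite_singleton _, fun v c h => ⟨[], rfl, ?_⟩⟩
    obtain ⟨g, hg, hgv⟩ := frequently_seqFilter_zero.1 h
    exact ⟨g, hg, by simpa using hgv.le⟩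
  | succ n ih =>
    obtain ⟨L, hL, ih⟩ := ih
    obtain ⟨G, hG, hGR⟩ := exists_finite_grid R hη
    refine ⟨Set.image2 List.cons G L, hG.image2 _ hL, fun v c h => ?_⟩
    rw [frequently_seqFilter_succ] at h
    have h1 : ∃ᶠ y in weakNhdsZero 𝕜 X ⊓ 𝓟 (Metric.closedBall (0 : X) 1), ∃ l ∈ L,
        ∃ f ∈ l.foldr szlenkDeriv K, c - n * η ≤ RCLike.re (f (v + y)) + l.sum := by
      refine h.mono fun y hy => ih (v + y) c (hy.mono fun z hz => ?_)
      simpa [Fin.sum_univ_succ, add_assoc] using hz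
    obtain ⟨l, hlL, h2⟩ : ∃ l ∈ L, ∃ᶠ y in weakNhdsZero 𝕜 X ⊓ 𝓟 (Metric.closedBall (0 : X) 1),
        ∃ f ∈ l.foldr szlenkDeriv K, c - n * η ≤ RCLike.re (f (v + y)) + l.sum := by
      by_contra! hcon
      refine h1 (((eventually_all_finite hL).2 hcon).mono fun y hy => ?_)
      rintro ⟨l, hl, f, hf, hfy⟩
      exact absurd hfy (not_le.2 (hy l hl f hf))
    clear h h1
    rw [frequently_iff_neBot] at h2
    set F := weakNhdsZero 𝕜 X ⊓ 𝓟 (Metric.closedBall (0 : X) 1) ⊓ 𝓟 {y : X |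
      ∃ f ∈ l.foldr szlenkDeriv K, c - n * η ≤ RCLike.re (f (v + y)) + l.sum} with hF
    let 𝒰 : Ultrafilter X := Ultrafilter.of F
    have h𝒰 : (𝒰 : Filter X) ≤ F := Ultrafilter.of_le F
    have hU1 : (𝒰 : Filter X) ≤ weakNhdsZero 𝕜 X := h𝒰.trans (inf_le_left.trans inf_le_left)
    have hU2 : ∀ᶠ y in (𝒰 : Filter X), ‖y‖ ≤ 1 := by
      have : Metric.closedBall (0 : X) 1 ∈ (𝒰 : Filter X) :=
        le_principal_iff.1 (h𝒰.trans (inf_le_left.trans inf_le_right))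
      filter_upwards [this] with y hy using by simpa using hy
    have hU3 : ∀ᶠ y in (𝒰 : Filter X), ∃ f ∈ l.foldr szlenkDeriv K,
        c - n * η ≤ RCLike.re (f (v + y)) + l.sum :=
      le_principal_iff.1 (h𝒰.trans inf_le_right)
    choose! φ hφK hφ using fun (y : X) (hy : ∃ f ∈ l.foldr szlenkDeriv K,
        c - n * η ≤ RCLike.re (f (v + y)) + l.sum) => hy
    have hK' : IsCompact (WeakDual.toStrongDual ⁻¹' l.foldr szlenkDeriv K) :=
      hK.of_isClosed_subset (isClosed_foldr_szlenkDeriv hK.isClosed l)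
        (Set.preimage_mono (foldr_szlenkDeriv_subset K l))
    obtain ⟨f, hf, hlim⟩ := hK'.ultrafilter_le_nhds (𝒰.map fun y => StrongDual.toWeakDual (φ y))
      (le_principal_iff.2 (hU3.mono hφK))
    obtain ⟨e, he, helim⟩ := (isCompact_Icc (a := -R) (b := R)).ultrafilter_le_nhds
      (𝒰.map fun y => RCLike.re (φ y y))
      (le_principal_iff.2 ((hU2.and hU3).mono fun y ⟨hy, hy3⟩ => by
        have h4 : ‖φ y y‖ ≤ R := by
          refine ((φ y).le_opNorm y).trans ?_
          have := hR _ (foldr_szlenkDeriv_subset K l (hφK y hy3))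
          nlinarith [norm_nonneg (φ y), norm_nonneg y]
        exact abs_le.1 ((RCLike.abs_re_le_norm _).trans h4)))
    have hlim : Tendsto (fun y => StrongDual.toWeakDual (φ y)) 𝒰 (𝓝 f) := hlim
    have helim : Tendsto (fun y => RCLike.re (φ y y)) 𝒰 (𝓝 e) := helim
    -- `f` is at distance about `e` from the `φ y`, so any `ε < e` is admissible.
    obtain ⟨ε, hεG, hε1, hε2⟩ := hGR e he
    refine ⟨ε :: l, ⟨ε, hεG, l, hlL, rfl⟩, WeakDual.toStrongDual f, ?_, ?_⟩
    · rw [List.foldr_cons, szlenkDeriv]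
      split_ifs with hε
      · exact hf
      refine ⟨hf, fun V hV => ?_⟩
      have h4 : Tendsto (fun y => RCLike.re (φ y y) - RCLike.re (f y)) 𝒰 (𝓝 (e - 0)) := by
        refine helim.sub ?_
        have := (RCLike.continuous_re.tendsto (0 : 𝕜)).comp
          ((tendsto_weakNhdsZero (WeakDual.toStrongDual f)).mono_left hU1)
        rwa [map_zero] at this
      have hV' : V ∈ 𝓝 f := hV
      have hfV : f ∈ V := mem_of_mem_nhds hV'
      obtain ⟨y, hy1, hyK, hyV, hyε⟩ := (hU2.and (hU3.and ((hlim.eventually hV').and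
        (h4.eventually (lt_mem_nhds (show ε < e - 0 by linarith)))))).exists
      refine lt_of_lt_of_le ?_ (Metric.edist_le_ediam_of_mem (x := φ y)
        (y := WeakDual.toStrongDual f) ⟨hyV, hφK y hyK⟩
        ⟨hfV, hf⟩)
      rw [edist_dist, dist_eq_norm]
      refine (ENNReal.ofReal_lt_ofReal_iff_of_nonneg (not_le.1 hε).le).2 (hyε.trans_le ?_)
      have h5 := (φ y - WeakDual.toStrongDual f).le_opNorm y
      have h6 : RCLike.re (φ y y) - RCLike.re (f y) =
        RCLike.re ((φ y - WeakDual.toStrongDual f) y) := by simp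
      rw [h6]
      refine (RCLike.re_le_norm _).trans (h5.trans ?_)
      exact mul_le_of_le_one_right (norm_nonneg _) hy1
    · have h4 : Tendsto (fun y => RCLike.re (φ y v) + RCLike.re (φ y y) + l.sum) 𝒰
          (𝓝 (RCLike.re (f v) + e + l.sum)) := by
        refine (Tendsto.add ?_ helim).add_const _
        exact ((RCLike.continuous_re.comp (WeakDual.eval_continuous v)).tendsto f).comp hlim
      have h5 : c - n * η ≤ RCLike.re (f v) + e + l.sum := by
        refine ge_of_tendsto h4 (hU3.mono fun y hy => ?_)
        simpa using hφ y hy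
      push_cast
      simp only [List.sum_cons, WeakDual.toStrongDual_apply]
      linarith

lemma isCompact_adjointBall (A : X →L[𝕜] Y) :
    IsCompact (WeakDual.toStrongDual ⁻¹' adjointBall A) := by
  have h1 := WeakDual.isCompact_closedBall (𝕜 := 𝕜) (E := Y) 0 1
  let T : WeakDual 𝕜 Y → WeakDual 𝕜 X := fun g =>
    StrongDual.toWeakDual ((WeakDual.toStrongDual g).comp A)
  have hT : Continuous T := WeakDual.continuous_of_continuous_eval fun x =>
    WeakDual.eval_continuous (A x)
  convert h1.image hT using 1
  ext f
  constructor
  · rintro ⟨g, hg, hgf⟩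
    exact ⟨StrongDual.toWeakDual g, hg, by simp only [T]; exact congrArg _ hgf⟩
  · rintro ⟨g, hg, rfl⟩
    exact ⟨WeakDual.toStrongDual g, hg, rfl⟩

theorem opSigma_lt_top_iff_hasSummableSzlenk (A : X →L[𝕜] Y) :
    opSigma A < ⊤ ↔ OpHasSummableSzlenk A := by
  rw [opSigma_lt_top_iff]
  constructor
  · rintro ⟨c, hc⟩
    have hc0 : 0 ≤ c := (norm_nonneg _).trans (eventually_seqFilter_zero.1 (hc 0))
    refine ⟨5 * c, by linarith, fun l hl => ?_⟩
    obtain ⟨f, hf⟩ := hl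
    have := re_add_sum_le_of_mem_foldr l f hf 0 ((hc l.length).mono fun z hz g hg => by
      rw [zero_add]
      exact (re_le_of_mem_adjointBall hg _).trans hz)
    simp only [map_zero] at this
    linarith
  · rintro ⟨M, -, hM⟩
    refine ⟨M + 2, fun n => ?_⟩
    by_contra hcon
    have hR : ∀ f ∈ adjointBall A, ‖f‖ ≤ ‖A‖ := by
      rintro _ ⟨g, hg, rfl⟩
      exact (g.opNorm_comp_le A).trans (mul_le_of_le_one_left (norm_nonneg _) (by simpa using hg))
    obtain ⟨L, -, hL⟩ := exists_mem_foldr_szlenkDeriv (isCompact_adjointBall A) hR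
      (η := 1 / (n + 1)) (by positivity) n
    obtain ⟨l, -, f, hf, h⟩ := hL 0 (M + 2) ((not_eventually.1 hcon).mono fun z hz => by
      obtain ⟨g, hg, hgz⟩ := exists_mem_adjointBall_re_eq A (∑ i, z i)
      refine ⟨g, hg, ?_⟩
      rw [zero_add, hgz]
      exact not_le.1 hz)
    have h1 := hM l ⟨f, hf⟩
    have h2 : (n : ℝ) * (1 / (n + 1)) ≤ 1 := by
      rw [mul_one_div, div_le_one (by positivity)]
      linarith
    simp only [map_zero] at h
    linarith

end Szlenk

/-! ### Asymptotic norms -/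

section Asymptotic

variable {𝕜 : Type*} [RCLike 𝕜] {X : Type u} [NormedAddCommGroup X] [NormedSpace 𝕜 X]

lemma eventually_lt_norm_add {v : X} {r : ℝ} (h : r < ‖v‖) :
    ∀ᶠ y in weakNhdsZero 𝕜 X, r < ‖v + y‖ := by
  obtain ⟨f, hf, hfv⟩ := exists_dual_vector'' 𝕜 v
  have h1 : Tendsto (fun y => ‖f (v + y)‖) (weakNhdsZero 𝕜 X) (𝓝 ‖f v + 0‖) := by
    simp only [map_add]
    exact ((tendsto_weakNhdsZero f).const_add _).norm
  have h2 : r < ‖f v + 0‖ := by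
    rw [hfv]
    simpa using h
  refine (h1.eventually (lt_mem_nhds h2)).mono fun y hy => hy.trans_le ?_
  exact (f.le_opNorm _).trans (mul_le_of_le_one_left (norm_nonneg _) hf)

lemma eventually_lt_norm_add_sum (S : Set X) {n : ℕ} {v : X} {r : ℝ} (h : r < ‖v‖) :
    ∀ᶠ z in seqFilter 𝕜 S n, r < ‖v + ∑ i, z i‖ := by
  induction n generalizing v with
  | zero => simpa [eventually_seqFilter_zero] using h
  | succ n ih =>
    refine eventually_seqFilter_succ.2 (((eventually_lt_norm_add h).filter_mono inf_le_left).mono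
      fun y hy => (ih hy).mono fun z hz => ?_)
    simpa [Fin.sum_univ_succ, add_assoc] using hz

/-- Weakly null sequences of unit vectors essentially dominate half of the `ℓ_∞` norm. -/
lemma eventually_lt_norm_add_sum_smul {n : ℕ} (a : Fin n → 𝕜) (j : Fin n) (v : X) {r : ℝ}
    (h : r < ‖a j‖ / 2) :
    ∀ᶠ z in seqFilter 𝕜 (Metric.sphere (0 : X) 1) n, r < ‖v + ∑ i, a i • z i‖ := by
  induction n generalizing v with
  | zero => exact j.elim0
  | succ n ih =>
    rw [eventually_seqFilter_succ]
    refine Fin.cases (fun h => ?_) (fun j h => ?_) j h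
    · have h1 : ∀ᶠ y in weakNhdsZero 𝕜 X ⊓ 𝓟 (Metric.sphere (0 : X) 1), r < ‖v + a 0 • y‖ := by
        rcases lt_or_ge r ‖v‖ with hv | hv
        · exact ((tendsto_smul_weakNhdsZero (a 0)).eventually
            (eventually_lt_norm_add hv)).filter_mono inf_le_left
        · refine eventually_inf_principal.2 (Eventually.of_forall fun y hy => ?_)
          have h2 : ‖a 0 • y‖ = ‖a 0‖ := by rw [norm_smul, mem_sphere_zero_iff_norm.1 hy, mul_one]
          have h3 : ‖a 0 • y‖ ≤ ‖v + a 0 • y‖ + ‖v‖ := by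
            simpa using norm_sub_le (v + a 0 • y) v
          linarith
      refine h1.mono fun y hy => ?_
      have h2 := (tendsto_smul_seqFilter (S := Metric.sphere (0 : X) 1) (B := Set.univ)
        (fun i => a i.succ) fun _ _ _ => trivial).eventually
          (eventually_lt_norm_add_sum (𝕜 := 𝕜) Set.univ hy)
      refine h2.mono fun z hz => ?_
      simpa [Fin.sum_univ_succ, add_assoc] using hz
    · refine Eventually.of_forall fun y => (ih (fun i => a i.succ) j (v + a 0 • y) h).mono
        fun z hz => ?_
      simpa [Fin.sum_univ_succ, add_assoc] using hz

lemma exists_one_le_norm_apply {n : ℕ} {a : Fin n → 𝕜} (ha : ‖a‖ = 1) : ∃ j, 1 ≤ ‖a j‖ := by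
  by_contra! h
  exact absurd ha ((pi_norm_lt_iff one_pos).2 h).ne

lemma bounds_of_bounds_on_sphere {n : ℕ} (p : Seminorm 𝕜 (Fin n → 𝕜)) {c C : ℝ}
    (h : ∀ a, ‖a‖ = 1 → c ≤ p a ∧ p a ≤ C) (a : Fin n → 𝕜) : c * ‖a‖ ≤ p a ∧ p a ≤ C * ‖a‖ := by
  rcases eq_or_ne a 0 with rfl | ha
  · simp
  have h0 : 0 < ‖a‖ := norm_pos_iff.2 ha
  have h1 := h (((‖a‖⁻¹ : ℝ) : 𝕜) • a) (by
    rw [norm_smul, RCLike.norm_ofReal, abs_of_pos (inv_pos.2 h0), inv_mul_cancel₀ h0.ne'])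
  rw [map_smul_eq_mul, RCLike.norm_ofReal, abs_of_pos (inv_pos.2 h0), inv_mul_eq_div,
    le_div_iff₀ h0, div_le_iff₀ h0] at h1
  exact h1

theorem isAsymptoticC0_of_opSigma_lt_top (hX : ¬ FiniteDimensional 𝕜 X)
    (h : opSigma (ContinuousLinearMap.id 𝕜 X) < ⊤) : IsAsymptoticC0 𝕜 X := by
  obtain ⟨c, hc⟩ := (opSigma_lt_top_iff _).1 h
  refine ⟨hX, max (2 * c) 8, le_max_of_le_right (by norm_num), fun n _ p hp => ?_⟩
  obtain ⟨-, hp⟩ := hp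
  obtain ⟨D, _, _, _, x, hx, hx1, hxp⟩ := hp 2 one_lt_two
  refine bounds_of_bounds_on_sphere p fun a ha => ?_
  have hxS : ∀ t : List D, 1 ≤ t.length → t.length ≤ n → x t ∈ Metric.sphere (0 : X) 1 :=
    fun t h1 h2 => by simpa using hx1 t h1 h2
  constructor
  · obtain ⟨j, hj⟩ := exists_one_le_norm_apply ha
    obtain ⟨t, ht, hQ⟩ := hx.exists_branch hxS
      (eventually_lt_norm_add_sum_smul a j (0 : X) (r := 1 / 4) (by linarith))
    have h1 := (hxp a ha t ht).1
    rw [zero_add] at hQ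
    simp only [branch] at hQ
    have h2 : (max (2 * c) 8)⁻¹ ≤ 8⁻¹ := inv_anti₀ (by norm_num) (le_max_right _ _)
    linarith
  · have hmem : ∀ i, ∀ x ∈ Metric.sphere (0 : X) 1, a i • x ∈ Metric.closedBall (0 : X) 1 := by
      intro i x hx
      rw [mem_closedBall_zero_iff, norm_smul, mem_sphere_zero_iff_norm.1 hx, mul_one, ← ha]
      exact norm_le_pi_norm a i
    obtain ⟨t, ht, hQ⟩ := hx.exists_branch hxS ((tendsto_smul_seqFilter a hmem).eventually (hc n))
    have h1 := (hxp a ha t ht).2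
    simp only [branch, ContinuousLinearMap.id_apply] at hQ
    exact (h1.trans (by linarith)).trans (le_max_left _ _)

/-- A convex set which contains the unit vectors of some weak neighbourhood of zero also contains
the vectors of the unit ball of some weak neighbourhood: in an infinite dimensional space, every
vector of the ball lies on a segment with end points on the sphere whose direction is annihilated by
finitely many given functionals. -/
lemma eventually_closedBall_of_eventually_sphere (hX : ¬ FiniteDimensional 𝕜 X) {G : Set X}
    (hG : ∀ x ∈ G, ∀ y ∈ G, ∀ θ ∈ Set.Icc (0 : ℝ) 1,
      (θ : 𝕜) • x + ((1 - θ : ℝ) : 𝕜) • y ∈ G)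
    (h : ∀ᶠ y in weakNhdsZero 𝕜 X ⊓ 𝓟 (Metric.sphere (0 : X) 1), y ∈ G) :
    ∀ᶠ y in weakNhdsZero 𝕜 X ⊓ 𝓟 (Metric.closedBall (0 : X) 1), y ∈ G := by
  rw [eventually_inf_principal] at h ⊢
  obtain ⟨s, hs, r, hr, hsr⟩ := mem_weakNhdsZero_iff.1 h
  have := hs.fintype
  obtain ⟨z, hz, hzs⟩ : ∃ z : X, z ≠ 0 ∧ ∀ f ∈ s, f z = 0 := by
    by_contra! hcon
    let T : X →ₗ[𝕜] (s → 𝕜) := LinearMap.pi fun f : s => ((f : StrongDual 𝕜 X) : X →ₗ[𝕜] 𝕜)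
    refine hX (FiniteDimensional.of_injective T ?_)
    rw [← LinearMap.ker_eq_bot, LinearMap.ker_eq_bot']
    intro z hz
    by_contra hz0
    obtain ⟨f, hf, hfz⟩ := hcon z hz0
    exact hfz (congrFun hz ⟨f, hf⟩)
  have hz0 : 0 < ‖z‖ := norm_pos_iff.2 hz
  -- Moving from a vector of the ball in the direction `w` one meets the sphere.
  have key : ∀ x : X, ‖x‖ ≤ 1 → ∀ w : X, ‖w‖ = ‖z‖ → ∃ t : ℝ, 0 ≤ t ∧ ‖x + (t : 𝕜) • w‖ = 1 := by
    intro x hx w hw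
    have hcont : Continuous fun t : ℝ => ‖x + (t : 𝕜) • w‖ :=
      (continuous_const.add (RCLike.continuous_ofReal.smul continuous_const)).norm
    have h2 : 0 ≤ 2 / ‖z‖ := by positivity
    have h3 : 1 ≤ ‖x + ((2 / ‖z‖ : ℝ) : 𝕜) • w‖ := by
      have h4 : ‖((2 / ‖z‖ : ℝ) : 𝕜) • w‖ = 2 := by
        rw [norm_smul, RCLike.norm_ofReal, abs_of_nonneg h2, hw, div_mul_cancel₀ _ hz0.ne']
      have h5 : ‖((2 / ‖z‖ : ℝ) : 𝕜) • w‖ ≤ ‖x + ((2 / ‖z‖ : ℝ) : 𝕜) • w‖ + ‖x‖ := by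
        simpa using norm_sub_le (x + ((2 / ‖z‖ : ℝ) : 𝕜) • w) x
      linarith
    obtain ⟨t, ht, ht1⟩ := intermediate_value_Icc h2 hcont.continuousOn
      (show (1 : ℝ) ∈ Set.Icc _ _ from ⟨by simpa using hx, h3⟩)
    exact ⟨t, ht.1, ht1⟩
  refine mem_weakNhdsZero_iff.2 ⟨s, hs, r, hr, fun x hx hxB => ?_⟩
  have hxB : ‖x‖ ≤ 1 := by simpa using hxB
  obtain ⟨t, ht, htx⟩ := key x hxB z rfl
  obtain ⟨t', ht', htx'⟩ := key x hxB (-z) (norm_neg z)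
  have h1 : x + (t : 𝕜) • z ∈ G := hsr (fun f hf => by
    rw [map_add, map_smul, hzs f hf, smul_zero, add_zero]; exact hx f hf) (by simpa using htx)
  have h2 : x + (t' : 𝕜) • (-z) ∈ G := hsr (fun f hf => by
    rw [map_add, map_smul, map_neg, hzs f hf, neg_zero, smul_zero, add_zero]; exact hx f hf)
    (by simpa using htx')
  rcases eq_or_lt_of_le ht with rfl | htpos
  · simpa using h1
  have hθ : t' / (t + t') ∈ Set.Icc (0 : ℝ) 1 :=
    ⟨by positivity, by rw [div_le_one (by positivity)]; linarith⟩
  have h3 := hG _ h1 _ h2 _ hθ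
  have h4 : ((t' / (t + t') : ℝ) : 𝕜) • (x + (t : 𝕜) • z) +
      ((1 - t' / (t + t') : ℝ) : 𝕜) • (x + (t' : 𝕜) • (-z)) = x := by
    have h5 : t' / (t + t') * t - (1 - t' / (t + t')) * t' = 0 := by
      field_simp
      ring
    have h6 : ((t' / (t + t') : ℝ) : 𝕜) * (t : 𝕜) -
        ((1 - t' / (t + t') : ℝ) : 𝕜) * (t' : 𝕜) = 0 := by
      rw [← RCLike.ofReal_mul, ← RCLike.ofReal_mul, ← RCLike.ofReal_sub, h5, RCLike.ofReal_zero]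
    have h7 : ((t' / (t + t') : ℝ) : 𝕜) + ((1 - t' / (t + t') : ℝ) : 𝕜) = 1 := by
      rw [← RCLike.ofReal_add, add_sub_cancel, RCLike.ofReal_one]
    calc _ = (((t' / (t + t') : ℝ) : 𝕜) + ((1 - t' / (t + t') : ℝ) : 𝕜)) • x +
        (((t' / (t + t') : ℝ) : 𝕜) * (t : 𝕜) - ((1 - t' / (t + t') : ℝ) : 𝕜) * (t' : 𝕜)) • z := by
          module
      _ = x := by rw [h6, h7, one_smul, zero_smul, add_zero]
  rwa [h4] at h3

/-- Upper bounds for sums of weakly null sequences in the sphere pass to the ball: the vectors for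
which the bound holds form a convex set. -/
lemma eventually_norm_add_sum_le_closedBall (hX : ¬ FiniteDimensional 𝕜 X) {n : ℕ} {v : X} {c : ℝ}
    (h : ∀ᶠ z in seqFilter 𝕜 (Metric.sphere (0 : X) 1) n, ‖v + ∑ i, z i‖ ≤ c) :
    ∀ᶠ z in seqFilter 𝕜 (Metric.closedBall (0 : X) 1) n, ‖v + ∑ i, z i‖ ≤ c := by
  induction n generalizing v with
  | zero => exact h
  | succ n ih =>
    rw [eventually_seqFilter_succ] at h ⊢
    simp only [Fin.sum_univ_succ, Matrix.cons_val_zero, Matrix.cons_val_succ, ← add_assoc] at h ⊢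
    refine eventually_closedBall_of_eventually_sphere hX (G := {y | ∀ᶠ z : Fin n → X in seqFilter 𝕜
      (Metric.closedBall (0 : X) 1) n, ‖v + y + ∑ i, z i‖ ≤ c}) ?_ (h.mono fun y hy => ih hy)
    intro x hx y hy θ hθ
    filter_upwards [hx, hy] with z hzx hzy
    have h1 : (θ : 𝕜) + ((1 - θ : ℝ) : 𝕜) = 1 := by
      rw [← RCLike.ofReal_add, add_sub_cancel, RCLike.ofReal_one]
    have h2 : v + ((θ : 𝕜) • x + ((1 - θ : ℝ) : 𝕜) • y) + ∑ i, z i =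
        (θ : 𝕜) • (v + x + ∑ i, z i) + ((1 - θ : ℝ) : 𝕜) • (v + y + ∑ i, z i) := by
      calc _ = ((θ : 𝕜) + ((1 - θ : ℝ) : 𝕜)) • (v + ∑ i, z i) +
            ((θ : 𝕜) • x + ((1 - θ : ℝ) : 𝕜) • y) := by rw [h1, one_smul]; abel
        _ = _ := by module
    have h3 : 0 ≤ 1 - θ := by linarith [hθ.2]
    rw [h2]
    refine (norm_add_le _ _).trans ?_
    rw [norm_smul, norm_smul, RCLike.norm_ofReal, RCLike.norm_ofReal, abs_of_nonneg hθ.1,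
      abs_of_nonneg h3]
    nlinarith [mul_le_mul_of_nonneg_left hzx hθ.1, mul_le_mul_of_nonneg_left hzy h3]

lemma norm_sum_smul_le {n : ℕ} (a : Fin n → 𝕜) {z : Fin n → X} (hz : ∀ i, ‖z i‖ = 1) :
    ‖∑ i, a i • z i‖ ≤ n * ‖a‖ := by
  refine (norm_sum_le _ _).trans ((Finset.sum_le_sum fun i _ => ?_).trans_eq
    (b := ∑ _i : Fin n, ‖a‖) (by simp))
  rw [norm_smul, hz, mul_one]
  exact norm_le_pi_norm a i

/-- Every property that holds frequently for weakly null sequences of unit vectors comes with an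
asymptotic norm, the limit of `‖∑ a_i z_i‖` along an ultrafilter on which the property holds. -/
lemma exists_isAsymptoticNorm {n : ℕ} {Q : (Fin n → X) → Prop}
    (hQ : ∃ᶠ z in seqFilter 𝕜 (Metric.sphere (0 : X) 1) n, Q z) :
    ∃ p : Seminorm 𝕜 (Fin n → 𝕜), IsAsymptoticNorm 𝕜 X n p ∧
      ∀ (a : Fin n → 𝕜) (c : ℝ), (∀ z, Q z → c ≤ ‖∑ i, a i • z i‖) → c ≤ p a := by
  rw [frequently_iff_neBot] at hQ
  let 𝒰 : Ultrafilter (Fin n → X) :=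
    Ultrafilter.of (seqFilter 𝕜 (Metric.sphere (0 : X) 1) n ⊓ 𝓟 {z | Q z})
  have h𝒰 : (𝒰 : Filter _) ≤ seqFilter 𝕜 (Metric.sphere (0 : X) 1) n ⊓ 𝓟 {z | Q z} :=
    Ultrafilter.of_le _
  have hU1 : (𝒰 : Filter _) ≤ seqFilter 𝕜 (Metric.sphere (0 : X) 1) n := h𝒰.trans inf_le_left
  have hUQ : ∀ᶠ z in (𝒰 : Filter _), Q z := le_principal_iff.1 (h𝒰.trans inf_le_right)
  have hU2 : ∀ᶠ z : Fin n → X in (𝒰 : Filter _), ∀ i, ‖z i‖ = 1 :=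
    ((eventually_seqFilter_mem _ n).filter_mono hU1).mono fun z hz i => by simpa using hz i
  have hlim : ∀ a : Fin n → 𝕜, ∃ c, Tendsto (fun z : Fin n → X => ‖∑ i, a i • z i‖) 𝒰 (𝓝 c) := by
    intro a
    obtain ⟨c, -, hc⟩ := (isCompact_Icc (a := 0) (b := n * ‖a‖)).ultrafilter_le_nhds
      (𝒰.map fun z : Fin n → X => ‖∑ i, a i • z i‖) (le_principal_iff.2 (hU2.mono fun z hz =>
        ⟨norm_nonneg _, norm_sum_smul_le a hz⟩))
    exact ⟨c, hc⟩
  choose q hq using hlim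
  let p : Seminorm 𝕜 (Fin n → 𝕜) := Seminorm.of q
    (fun a b => by
      refine le_of_tendsto_of_tendsto' (hq (a + b)) ((hq a).add (hq b)) fun z => ?_
      simp only [Pi.add_apply, add_smul, Finset.sum_add_distrib]
      exact norm_add_le _ _)
    (fun c a => by
      refine tendsto_nhds_unique (hq (c • a)) (((hq a).const_mul ‖c‖).congr fun z => ?_)
      rw [← norm_smul, Finset.smul_sum]
      simp [mul_smul])
  have hpq : ∀ a, p a = q a := fun a => rfl
  have hpn : ∀ a, p a ≤ n * ‖a‖ := fun a =>
    le_of_tendsto (hq a) (hU2.mono fun z hz => norm_sum_smul_le a hz)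
  have hp2 : ∀ a, ‖a‖ = 1 → 1 / 2 ≤ p a := by
    intro a ha
    obtain ⟨j, hj⟩ := exists_one_le_norm_apply ha
    refine le_of_forall_lt fun r hr => ?_
    obtain ⟨r', hr, hr'⟩ := exists_between hr
    refine hr.trans_le (ge_of_tendsto (hq a) ?_)
    refine ((eventually_lt_norm_add_sum_smul a j (0 : X) (r := r')
      (by linarith)).filter_mono hU1).mono fun z hz => ?_
    simpa using hz.le
  -- The limit is uniform on the unit sphere of `𝕜^n`.
  have hunif : ∀ ε > 0, ∀ᶠ z : Fin n → X in (𝒰 : Filter _), ∀ a : Fin n → 𝕜, ‖a‖ = 1 →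
      |‖∑ i, a i • z i‖ - p a| ≤ ε := by
    intro ε hε
    obtain ⟨t, hts, ht, hcov⟩ := Metric.finite_approx_of_totallyBounded
      (isCompact_sphere (0 : Fin n → 𝕜) 1).totallyBounded (ε / (3 * (n + 1))) (by positivity)
    have h1 : ∀ᶠ z : Fin n → X in (𝒰 : Filter _), ∀ b ∈ t, |‖∑ i, b i • z i‖ - p b| < ε / 3 := by
      refine (eventually_all_finite ht).2 fun b _ => ?_
      have := Metric.tendsto_nhds.1 (hq b) (ε / 3) (by positivity)
      exact this.mono fun z hz => by rwa [hpq, ← Real.dist_eq]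
    filter_upwards [h1, hU2] with z hz hz1 a ha
    have := hcov (show a ∈ Metric.sphere 0 1 by simpa using ha)
    simp only [Set.mem_iUnion, Metric.mem_ball] at this
    obtain ⟨b, hb, hab⟩ := this
    have h2 : n * ‖a - b‖ ≤ ε / 3 := by
      rw [dist_eq_norm, lt_div_iff₀ (by positivity)] at hab
      nlinarith [norm_nonneg (a - b)]
    have h3 : |‖∑ i, a i • z i‖ - ‖∑ i, b i • z i‖| ≤ n * ‖a - b‖ := by
      refine (abs_norm_sub_norm_le _ _).trans ?_
      rw [← Finset.sum_sub_distrib]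
      simp only [← sub_smul]
      exact norm_sum_smul_le (a - b) hz1
    have h4 : |p a - p b| ≤ n * ‖a - b‖ :=
      (abs_sub_map_le_sub p a b).trans (hpn _)
    have h5 := hz b hb
    rw [abs_le] at h3 h4 ⊢
    rw [abs_lt] at h5
    constructor <;> linarith [h3.1, h3.2, h4.1, h4.2, h5.1, h5.2]
  refine ⟨p, ⟨fun a ha => ?_, fun b hb => ?_⟩, fun a c hc => ge_of_tendsto (hq a) (hUQ.mono hc)⟩
  · have := (bounds_of_bounds_on_sphere p (C := n) fun a ha =>
      ⟨hp2 a ha, by simpa [ha] using hpn a⟩) a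
    have h1 := norm_nonneg a
    exact norm_eq_zero.1 (by linarith [this.1])
  · have hε : 0 < (b - 1) / (2 * b) := div_pos (by linarith) (by linarith)
    obtain ⟨x, hx, hxS, hxQ⟩ := exists_weaklyNull_tree ((hunif _ hε).frequently.filter_mono hU1)
    refine ⟨WeakNhdIndex 𝕜 X, inferInstance, inferInstance, inferInstance, x, hx,
      fun t h1 h2 => by simpa using hxS t h1 h2, fun a ha t ht => ?_⟩
    have h1 := abs_le.1 (hxQ t ht a ha)
    have h2 := hp2 a ha
    simp only [branch] at h1
    have hb0 : 0 < b := by linarith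
    have h3 : b * ((b - 1) / (2 * b)) = (b - 1) / 2 := by field_simp
    have h4 : (b - 1) / (2 * b) ≤ (b - 1) / 2 := by
      refine div_le_div_of_nonneg_left (by linarith) two_pos (by linarith)
    constructor
    · rw [inv_mul_le_iff₀ hb0]
      nlinarith
    · nlinarith [mul_le_mul_of_nonneg_left h1.1 hb0.le]

theorem opSigma_lt_top_of_isAsymptoticC0 (h : IsAsymptoticC0 𝕜 X) :
    opSigma (ContinuousLinearMap.id 𝕜 X) < ⊤ := by
  obtain ⟨hX, C, hC1, hC⟩ := h
  refine (opSigma_lt_top_iff _).2 ⟨C + 1, fun n => ?_⟩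
  rcases Nat.eq_zero_or_pos n with rfl | hn
  · refine Eventually.of_forall fun z => ?_
    simp only [Finset.univ_eq_empty, Finset.sum_empty, map_zero, norm_zero]
    linarith
  have h1 : ∀ᶠ z in seqFilter 𝕜 (Metric.sphere (0 : X) 1) n, ‖0 + ∑ i, z i‖ ≤ C + 1 := by
    by_contra hcon
    obtain ⟨p, hp, hpQ⟩ := exists_isAsymptoticNorm (not_eventually.1 hcon)
    have h2 := hpQ 1 (C + 1) fun z hz => by simpa using (not_le.1 hz).le
    have h3 := (hC n hn p hp 1).2
    have h4 : ‖(1 : Fin n → 𝕜)‖ ≤ 1 := (pi_norm_le_iff_of_nonneg zero_le_one).2 fun i => by simp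
    nlinarith
  simpa using eventually_norm_add_sum_le_closedBall hX h1

end Asymptotic

/-! ### Finite dimensional decompositions -/

section FDD

variable {𝕜 : Type*} [RCLike 𝕜] {X : Type u} [NormedAddCommGroup X] [NormedSpace 𝕜 X]

/-- The sum of the spaces `E j`, `a ≤ j < b`. -/
def block (E : ℕ → Submodule 𝕜 X) (a b : ℕ) : Submodule 𝕜 X := ⨆ j ∈ Finset.Ico a b, E j

lemma le_block {E : ℕ → Submodule 𝕜 X} {a b j : ℕ} (h1 : a ≤ j) (h2 : j < b) : E j ≤ block E a b :=
  le_iSup₂_of_le (f := fun j (_ : j ∈ Finset.Ico a b) => E j) j (Finset.mem_Ico.2 ⟨h1, h2⟩) le_rfl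

lemma block_le_iff {E : ℕ → Submodule 𝕜 X} {a b : ℕ} {V : Submodule 𝕜 X} :
    block E a b ≤ V ↔ ∀ j, a ≤ j → j < b → E j ≤ V := by
  simp [block]

lemma block_mono {E : ℕ → Submodule 𝕜 X} {a b a' b' : ℕ} (ha : a' ≤ a) (hb : b ≤ b') :
    block E a b ≤ block E a' b' :=
  block_le_iff.2 fun _ h1 h2 => le_block (ha.trans h1) (h2.trans_le hb)

lemma block_blocking {E F : ℕ → Submodule 𝕜 X} {m : ℕ → ℕ} (hm : StrictMono m)
    (hF : ∀ j, F j = block E (m j) (m (j + 1))) {a b : ℕ} (hab : a ≤ b) :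
    block F a b = block E (m a) (m b) := by
  refine le_antisymm (block_le_iff.2 fun j h1 h2 => ?_) (block_le_iff.2 fun i h1 h2 => ?_)
  · rw [hF]
    exact block_mono (hm.monotone h1) (hm.monotone h2)
  · obtain ⟨j, hj1, hj2, hj3, hj4⟩ : ∃ j, a ≤ j ∧ j < b ∧ m j ≤ i ∧ i < m (j + 1) := by
      induction b, hab using Nat.le_induction with
      | base => omega
      | succ b hab ih =>
        rcases lt_or_ge i (m b) with h | h
        · obtain ⟨j, hj⟩ := ih h
          exact ⟨j, hj.1, by omega, hj.2.2⟩
        · exact ⟨b, hab, by omega, h, h2⟩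
    refine le_trans ?_ (le_block hj1 hj2)
    rw [hF]
    exact le_block hj3 hj4

variable {E : ℕ → Submodule 𝕜 X}

lemma IsFDD.finiteDimensional_block (hE : IsFDD E) (a b : ℕ) :
    FiniteDimensional 𝕜 (block E a b) := by
  have := hE.1
  rw [block, ← Finset.sup_eq_iSup]
  exact Submodule.finiteDimensional_finset_sup (Finset.Ico a b) E

lemma IsFDD.fddProj_eq (hE : IsFDD E) {x : X} {y : ℕ → X} (hy : ∀ j, y j ∈ E j)
    (hx : Tendsto (fun N => ∑ j ∈ Finset.range N, y j) atTop (𝓝 x)) (m : ℕ) :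
    fddProj hE m x = ∑ j ∈ Finset.range m, y j := by
  have h := (hE.2 x).unique (hE.2 x).choose_spec.1 ⟨hy, hx⟩
  rw [fddProj, h]

lemma IsFDD.tendsto_fddProj (hE : IsFDD E) (x : X) :
    Tendsto (fun m => fddProj hE m x) atTop (𝓝 x) :=
  (hE.2 x).choose_spec.1.2

lemma IsFDD.fddProj_sub_mem (hE : IsFDD E) (x : X) {a b : ℕ} (hab : a ≤ b) :
    fddProj hE b x - fddProj hE a x ∈ block E a b := by
  rw [fddProj, fddProj, ← Finset.sum_Ico_eq_sub _ hab]
  refine Submodule.sum_mem _ fun j hj => ?_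
  rw [Finset.mem_Ico] at hj
  exact le_block hj.1 hj.2 ((hE.2 x).choose_spec.1.1 j)

lemma IsFDD.fddProj_of_mem (hE : IsFDD E) {j : ℕ} {x : X} (hx : x ∈ E j) (m : ℕ) :
    fddProj hE m x = if j < m then x else 0 := by
  have h1 : ∀ N, ∑ i ∈ Finset.range N, (if i = j then x else 0) = if j < N then x else 0 := by
    intro N
    simp [Finset.sum_ite_eq']
  rw [hE.fddProj_eq (y := fun i => if i = j then x else 0), h1]
  · intro i
    split_ifs with h
    · rwa [h]
    · exact zero_mem _
  · refine tendsto_const_nhds.congr' ?_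
    filter_upwards [eventually_gt_atTop j] with N hN
    rw [h1, if_pos hN]

/-- The expansions `x = ∑ x_j` with respect to `E`, encoded by the continuous functions on `ℕ ∪ {∞}`
given by the partial sums. -/
def partialSums (E : ℕ → Submodule 𝕜 X) : Submodule 𝕜 C(OnePoint ℕ, X) where
  carrier := {S | S ((0 : ℕ) : OnePoint ℕ) = 0 ∧
    ∀ n : ℕ, S ((n + 1 : ℕ) : OnePoint ℕ) - S (n : OnePoint ℕ) ∈ E n}
  zero_mem' := ⟨rfl, fun n => by simp⟩
  add_mem' := by
    rintro S T ⟨hS, hS'⟩ ⟨hT, hT'⟩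
    refine ⟨by simp [hS, hT], fun n => ?_⟩
    have := add_mem (hS' n) (hT' n)
    rwa [sub_add_sub_comm] at this
  smul_mem' := by
    rintro c S ⟨hS, hS'⟩
    refine ⟨by simp [hS], fun n => ?_⟩
    have := (E n).smul_mem c (hS' n)
    rwa [smul_sub] at this

lemma isClosed_partialSums (hE : IsFDD E) :
    IsClosed (partialSums E : Set C(OnePoint ℕ, X)) := by
  have := hE.1
  have h : (partialSums E : Set C(OnePoint ℕ, X)) = {S | S ((0 : ℕ) : OnePoint ℕ) = 0} ∩
      ⋂ n : ℕ, {S | S ((n + 1 : ℕ) : OnePoint ℕ) - S (n : OnePoint ℕ) ∈ E n} := by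
    ext S
    simp only [Set.mem_inter_iff, Set.mem_iInter]
    exact Iff.rfl
  rw [h]
  refine (isClosed_eq (continuous_eval_const _) continuous_const).inter
    (isClosed_iInter fun n => ?_)
  exact (E n).closed_of_finiteDimensional.preimage
    ((continuous_eval_const _).sub (continuous_eval_const _))

lemma sum_range_partialSums {S : C(OnePoint ℕ, X)} (hS : S ∈ partialSums E) (m : ℕ) :
    ∑ j ∈ Finset.range m, (S ((j + 1 : ℕ) : OnePoint ℕ) - S (j : OnePoint ℕ)) =
      S (m : OnePoint ℕ) := by
  rw [Finset.sum_range_sub (fun j : ℕ => S (j : OnePoint ℕ)), hS.1, sub_zero]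

lemma tendsto_partialSums (S : C(OnePoint ℕ, X)) :
    Tendsto (fun n : ℕ => S (n : OnePoint ℕ)) atTop (𝓝 (S OnePoint.infty)) := by
  refine (S.continuous.tendsto _).comp ?_
  have := OnePoint.tendsto_coe_infty (X := ℕ)
  rwa [coclosedCompact_eq_cocompact, cocompact_eq_cofinite, Nat.cofinite_eq_atTop] at this

lemma fddProj_eq_of_mem_partialSums (hE : IsFDD E) {S : C(OnePoint ℕ, X)}
    (hS : S ∈ partialSums E) (m : ℕ) :
    fddProj hE m (S OnePoint.infty) = S (m : OnePoint ℕ) := by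
  rw [hE.fddProj_eq hS.2, sum_range_partialSums hS]
  simp only [sum_range_partialSums hS]
  exact tendsto_partialSums S

/-- The projections of a finite dimensional decomposition of a Banach space are linear and
uniformly bounded. -/
theorem IsFDD.exists_continuousLinearMap [CompleteSpace X] (hE : IsFDD E) :
    ∃ (P : ℕ → X →L[𝕜] X) (C : ℝ), 0 ≤ C ∧ (∀ m x, P m x = fddProj hE m x) ∧
      ∀ m x, ‖P m x‖ ≤ C * ‖x‖ := by
  have : CompleteSpace (partialSums E) := (isClosed_partialSums hE).completeSpace_coe
  let L : partialSums E →L[𝕜] X :=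
    (ContinuousMap.evalCLM 𝕜 (OnePoint.infty : OnePoint ℕ)).comp (partialSums E).subtypeL
  have hL : ∀ S : partialSums E, L S = S.1 OnePoint.infty := fun S => rfl
  have hinj : Function.Injective L := by
    intro S T h
    rw [hL, hL] at h
    refine Subtype.ext (ContinuousMap.ext fun i => ?_)
    induction i using OnePoint.rec with
    | infty => exact h
    | coe m =>
      rw [← fddProj_eq_of_mem_partialSums hE S.2, ← fddProj_eq_of_mem_partialSums hE T.2, h]
  have hsurj : Function.Surjective L := by
    intro x
    refine ⟨⟨OnePoint.continuousMapMkNat _ x (hE.tendsto_fddProj x), ?_, fun n => ?_⟩, rfl⟩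
    · change fddProj hE 0 x = 0
      simp [fddProj]
    · change fddProj hE (n + 1) x - fddProj hE n x ∈ E n
      rw [fddProj, fddProj, Finset.sum_range_succ_sub_sum]
      exact (hE.2 x).choose_spec.1.1 n
  let e := ContinuousLinearEquiv.ofBijective L (LinearMap.ker_eq_bot.2 hinj)
    (LinearMap.range_eq_top.2 hsurj)
  have he : ∀ x, (e.symm x).1 OnePoint.infty = x := fun x => e.apply_symm_apply x
  refine ⟨fun m => ((ContinuousMap.evalCLM 𝕜 (m : OnePoint ℕ)).comp (partialSums E).subtypeL).comp
    (e.symm : X →L[𝕜] partialSums E), ‖(e.symm : X →L[𝕜] partialSums E)‖, norm_nonneg _,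
    fun m x => ?_, fun m x => ?_⟩
  · have := fddProj_eq_of_mem_partialSums hE (e.symm x).2 m
    rw [he] at this
    exact this.symm
  · refine le_trans ?_ ((e.symm : X →L[𝕜] partialSums E).le_opNorm x)
    exact (e.symm x).1.norm_coe_le_norm _

lemma eq_zero_of_mem_block (hE : IsFDD E) {P : ℕ → X →L[𝕜] X} (hP : ∀ m x, P m x = fddProj hE m x)
    {a b m : ℕ} (h : m ≤ a) {x : X} (hx : x ∈ block E a b) : P m x = 0 := by
  have : block E a b ≤ LinearMap.ker (P m : X →ₗ[𝕜] X) := block_le_iff.2 fun j h1 _ x hx => by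
    simp [hP, hE.fddProj_of_mem hx, (h.trans h1).not_gt]
  exact this hx

lemma eq_self_of_mem_block (hE : IsFDD E) {P : ℕ → X →L[𝕜] X} (hP : ∀ m x, P m x = fddProj hE m x)
    {a b m : ℕ} (h : b ≤ m) {x : X} (hx : x ∈ block E a b) : P m x = x := by
  have : block E a b ≤ LinearMap.eqLocus (P m : X →ₗ[𝕜] X) LinearMap.id :=
    block_le_iff.2 fun j _ h2 x hx => by
      simp [hP, hE.fddProj_of_mem hx, h2.trans_le h]
  exact this hx

/-- Bounded sequences whose supports with respect to a shrinking decomposition move to infinity are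
weakly null. -/
lemma IsShrinking.eventually_mem [CompleteSpace X] {hE : IsFDD E} (h : IsShrinking hE) {U : Set X}
    (hU : U ∈ weakNhdsZero 𝕜 X) :
    ∀ᶠ N in atTop, ∀ N', ∀ x ∈ block E N N', ‖x‖ ≤ 1 → x ∈ U := by
  obtain ⟨P, -, -, hP, -⟩ := hE.exists_continuousLinearMap
  obtain ⟨s, hs, r, hr, hsr⟩ := mem_weakNhdsZero_iff.1 hU
  have h1 : ∀ f ∈ s, ∀ᶠ N in atTop, ∀ N', ∀ x ∈ block E N N', ‖x‖ ≤ 1 → ‖f x‖ < r := by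
    intro f _
    obtain ⟨g, hfg, m, f', hg⟩ := Metric.dense_iff.1 h f r hr
    filter_upwards [eventually_ge_atTop m] with N hN N' x hx hx1
    have h2 : g x = 0 := by rw [hg, ← hP, eq_zero_of_mem_block hE hP hN hx, map_zero]
    have h3 : f x = (f - g) x := by simp [h2]
    rw [Metric.mem_ball, dist_comm, dist_eq_norm] at hfg
    rw [h3]
    exact (((f - g).le_opNorm x).trans (mul_le_of_le_one_right (norm_nonneg _) hx1)).trans_lt hfg
  filter_upwards [(eventually_all_finite hs).2 h1] with N hN N' x hx hx1
  exact hsr fun f hf => hN f hf N' x hx hx1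

lemma tendsto_weakNhdsZero_of_finiteDimensional {V : Type*} [NormedAddCommGroup V] [NormedSpace 𝕜 V]
    [FiniteDimensional 𝕜 V] (T : X →L[𝕜] V) : Tendsto T (weakNhdsZero 𝕜 X) (𝓝 0) := by
  let e := (Module.finBasis 𝕜 V).equivFunL
  have h1 : Tendsto (fun x => e (T x)) (weakNhdsZero 𝕜 X) (𝓝 0) := by
    refine tendsto_pi_nhds.2 fun i => ?_
    exact tendsto_weakNhdsZero
      ((ContinuousLinearMap.proj (φ := fun _ => 𝕜) i).comp
        ((e : V →L[𝕜] (Fin (Module.finrank 𝕜 V) → 𝕜)).comp T))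
  have h2 := (e.symm.continuous.tendsto 0).comp h1
  rw [map_zero] at h2
  exact h2.congr fun x => e.symm_apply_apply (T x)

lemma IsFDD.tendsto_proj (hE : IsFDD E) {P : ℕ → X →L[𝕜] X} (hP : ∀ m x, P m x = fddProj hE m x)
    (m : ℕ) : Tendsto (P m) (weakNhdsZero 𝕜 X) (𝓝 0) := by
  have := hE.finiteDimensional_block 0 m
  have hmem : ∀ x, P m x ∈ block E 0 m := fun x => by
    have := hE.fddProj_sub_mem x (Nat.zero_le m)
    rw [hP]
    simpa [fddProj] using this
  have h := tendsto_weakNhdsZero_of_finiteDimensional ((P m).codRestrict (block E 0 m) hmem)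
  exact (continuous_subtype_val.tendsto _).comp h

end FDD

/-! ### Asymptotic `c_0` blockings -/

section Blocking

variable {𝕜 : Type*} [RCLike 𝕜] {X : Type u} [NormedAddCommGroup X] [NormedSpace 𝕜 X]
  {E : ℕ → Submodule 𝕜 X}

/-- A property that holds frequently for weakly null sequences in the ball holds for some small
perturbation of a block sequence of any given blocking, which may start arbitrarily far out. -/
lemma exists_block_approximation [CompleteSpace X] (hE : IsFDD E) {m : ℕ → ℕ} (hm : StrictMono m)
    {δ : ℝ} (hδ : 0 < δ) {n : ℕ} (K : ℕ) {Q : (Fin n → X) → Prop}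
    (hQ : ∃ᶠ z in seqFilter 𝕜 (Metric.closedBall (0 : X) 1) n, Q z) :
    ∃ z, Q z ∧ (∀ i, ‖z i‖ ≤ 1) ∧ ∃ k : Fin (n + 1) → ℕ, k 0 = K ∧
      (∀ i : Fin n, k i.castSucc < k i.succ) ∧ ∃ y : Fin n → X, ∀ i,
        y i ∈ block E (m (k i.castSucc)) (m (k i.succ)) ∧ ‖z i - y i‖ ≤ δ := by
  obtain ⟨P, -, -, hP, -⟩ := hE.exists_continuousLinearMap
  induction n generalizing K with
  | zero =>
    exact ⟨0, frequently_seqFilter_zero.1 hQ, fun i => i.elim0, fun _ => K, rfl,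
      fun i => i.elim0, 0, fun i => i.elim0⟩
  | succ n ih =>
    have h1 := (frequently_seqFilter_succ.1 hQ).and_eventually
      ((eventually_inf_principal.2 (Eventually.of_forall fun y hy => hy)).and
        ((((hE.tendsto_proj hP (m K)).norm.eventually (gt_mem_nhds
          (show ‖(0 : X)‖ < δ / 2 by simpa using half_pos hδ)))).filter_mono inf_le_left))
    obtain ⟨x, hxQ, hx1, hxK⟩ := h1.exists
    obtain ⟨K', hK', hKK'⟩ := ((((hE.tendsto_fddProj x).comp hm.tendsto_atTop).eventually
      (Metric.ball_mem_nhds x (half_pos hδ))).and (eventually_gt_atTop K)).exists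
    obtain ⟨z, hz, hz1, k, hk0, hk, y, hy⟩ := ih K' hxQ
    refine ⟨Matrix.vecCons x z, hz, ?_, Matrix.vecCons K k, rfl, ?_,
      Matrix.vecCons (P (m K') x - P (m K) x) y, ?_⟩
    · refine Fin.cases ?_ (fun i => ?_)
      · simpa using hx1
      · simpa using hz1 i
    · refine Fin.cases ?_ (fun i => ?_)
      · simpa [hk0] using hKK'
      · simpa [← Fin.succ_castSucc] using hk i
    · refine Fin.cases ⟨?_, ?_⟩ (fun i => ?_)
      · have := hE.fddProj_sub_mem x (hm.monotone hKK'.le)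
        simpa [hk0, hP] using this
      · have h2 : ‖x - P (m K') x‖ < δ / 2 := by
          rw [hP, ← dist_eq_norm, dist_comm]
          exact hK'
        have h3 : x - (P (m K') x - P (m K) x) = (x - P (m K') x) + P (m K) x := by abel
        simp only [Matrix.cons_val_zero]
        rw [h3]
        exact (norm_add_le _ _).trans (by linarith)
      · simpa [← Fin.succ_castSucc] using hy i

theorem opSigma_lt_top_of_isBlocking [CompleteSpace X] (hE : IsFDD E) {F : ℕ → Submodule 𝕜 X}
    (hFE : IsBlocking F E) (hF : IsAsymptoticC0In F) :
    opSigma (ContinuousLinearMap.id 𝕜 X) < ⊤ := by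
  obtain ⟨m, -, hm, hFm⟩ := hFE
  obtain ⟨C, hC1, hC⟩ := hF
  refine (opSigma_lt_top_iff _).2 ⟨2 * C + 1, fun n => ?_⟩
  rcases Nat.eq_zero_or_pos n with rfl | hn
  · refine Eventually.of_forall fun z => ?_
    simp only [Finset.univ_eq_empty, Finset.sum_empty, map_zero, norm_zero]
    linarith
  by_contra hcon
  have hn0 : (0 : ℝ) < n := by exact_mod_cast hn
  have hn1 : (1 : ℝ) ≤ n := by exact_mod_cast hn
  obtain ⟨z, hz, hz1, k, hk0, hk, y, hy⟩ := exists_block_approximation hE hm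
    (δ := 1 / n) (by positivity) n (not_eventually.1 hcon)
  refine hz ?_
  have h1 := (hC n hn k (Fin.strictMono_iff_lt_succ.2 hk) (by omega) y fun i => by
    have := (hy i).1
    rwa [← block_blocking hm hFm (hk i).le] at this).2
  have h2 : ‖y‖ ≤ 2 := (pi_norm_le_iff_of_nonneg zero_le_two).2 fun i => by
    have h3 : ‖y i‖ ≤ ‖z i‖ + ‖z i - y i‖ := by simpa using norm_sub_le (z i) (z i - y i)
    have h4 : (1 : ℝ) / n ≤ 1 := by rwa [div_le_one hn0]
    linarith [(hy i).2, hz1 i]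
  have h3 : ‖∑ i, (z i - y i)‖ ≤ 1 := by
    refine (norm_sum_le _ _).trans ((Finset.sum_le_sum fun i _ => (hy i).2).trans_eq ?_)
    simp [hn0.ne']
  have h4 : ∑ i, z i = ∑ i, y i + ∑ i, (z i - y i) := by
    rw [← Finset.sum_add_distrib]
    simp
  rw [ContinuousLinearMap.id_apply, h4]
  refine (norm_add_le _ _).trans ?_
  nlinarith

/-- `TailBound r s v`: adding `r` further vectors of the ball, successively chosen weakly close to
zero, to `v` does not increase the norm above `s`. -/
def TailBound (𝕜 : Type*) [RCLike 𝕜] {X : Type u} [NormedAddCommGroup X] [NormedSpace 𝕜 X] (r : ℕ)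
    (s : ℝ) (v : X) : Prop :=
  ∀ᶠ z in seqFilter 𝕜 (Metric.closedBall (0 : X) 1) r, ‖v + ∑ i, z i‖ ≤ s

lemma TailBound.mono {r : ℕ} {s s' : ℝ} {v : X} (h : TailBound 𝕜 r s v) (hs : s ≤ s') :
    TailBound 𝕜 r s' v :=
  Eventually.mono h fun _ hz => hz.trans hs

lemma TailBound.norm_le {r : ℕ} {s : ℝ} {v : X} (h : TailBound 𝕜 r s v) : ‖v‖ ≤ s := by
  have : ‖v + ∑ i : Fin r, (0 : Fin r → X) i‖ ≤ s :=
    pure_zero_le_seqFilter (𝕜 := 𝕜) (by simp) r h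
  simpa using this

/-- Since the relevant vectors `v` form a totally bounded set, the `TailBound`s are, up to a small
loss, preserved by all vectors that are supported far out, uniformly in `v`. -/
lemma IsShrinking.eventually_tailBound [CompleteSpace X] {hE : IsFDD E} (h : IsShrinking hE)
    (M r : ℕ) {s s' : ℝ} (hs : s < s') :
    ∀ᶠ N in atTop, ∀ v ∈ block E 0 M, TailBound 𝕜 (r + 1) s v →
      ∀ N', ∀ x ∈ block E N N', ‖x‖ ≤ 1 → TailBound 𝕜 r s' (v + x) := by
  have := hE.finiteDimensional_block 0 M
  have : ProperSpace (block E 0 M) := FiniteDimensional.proper 𝕜 _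
  have hA : TotallyBounded {v : X | v ∈ block E 0 M ∧ TailBound 𝕜 (r + 1) s v} := by
    refine ((isCompact_closedBall (0 : block E 0 M) s).image
      continuous_subtype_val).totallyBounded.subset ?_
    rintro v ⟨hv, hvs⟩
    exact ⟨⟨v, hv⟩, by simpa using hvs.norm_le, rfl⟩
  obtain ⟨t, htA, ht, hcov⟩ := Metric.finite_approx_of_totallyBounded hA (s' - s) (sub_pos.2 hs)
  have h1 : ∀ w ∈ t, ∀ᶠ N in atTop, ∀ N', ∀ x ∈ block E N N', ‖x‖ ≤ 1 →
      TailBound 𝕜 r s (w + x) := by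
    intro w hw
    have h2 := (htA hw).2
    rw [TailBound, eventually_seqFilter_succ, eventually_inf_principal] at h2
    filter_upwards [h.eventually_mem h2] with N hN N' x hx hx1
    refine Eventually.mono (hN N' x hx hx1 (by simpa using hx1)) fun z hz => ?_
    simpa [Fin.sum_univ_succ, add_assoc] using hz
  filter_upwards [(eventually_all_finite ht).2 h1] with N hN v hv hvs N' x hx hx1
  have := hcov (show v ∈ _ from ⟨hv, hvs⟩)
  simp only [Set.mem_iUnion, Metric.mem_ball] at this
  obtain ⟨w, hw, hvw⟩ := this
  refine Eventually.mono (hN w hw N' x hx hx1) fun z hz => ?_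
  have h3 : v + x + ∑ i, z i = (w + x + ∑ i, z i) + (v - w) := by abel
  rw [dist_eq_norm] at hvw
  rw [h3]
  exact (norm_add_le _ _).trans (by linarith)

/-- The bounds for the recursive choice of the blocking: they increase from `c` to `c + 1`. -/
noncomputable def levelBound (c : ℝ) (j : ℕ) : ℝ := c + 1 - (1 / 2) ^ j

lemma levelBound_strictMono (c : ℝ) : StrictMono (levelBound c) := by
  refine strictMono_nat_of_lt_succ fun j => ?_
  have : (0 : ℝ) < (1 / 2) ^ j := by positivity
  rw [levelBound, levelBound, pow_succ]
  linarith

lemma levelBound_le (c : ℝ) (j : ℕ) : levelBound c j ≤ c + 1 := by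
  have : (0 : ℝ) < (1 / 2) ^ j := by positivity
  rw [levelBound]
  linarith

lemma le_levelBound (c : ℝ) (j : ℕ) : c ≤ levelBound c j := by
  have : (1 / 2 : ℝ) ^ j ≤ 1 := pow_le_one₀ (by norm_num) (by norm_num)
  rw [levelBound]
  linarith

/-- For a vector supported in the first `j` blocks which bounds `r + 1 ≤ j + 1` further vectors, all
vectors of the ball supported after the next block can serve as the first of these. -/
lemma IsShrinking.exists_blocking [CompleteSpace X] {hE : IsFDD E} (h : IsShrinking hE) (c : ℝ) :
    ∃ m : ℕ → ℕ, m 0 = 0 ∧ StrictMono m ∧ ∀ j, ∀ r ≤ j, ∀ v ∈ block E 0 (m j),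
      TailBound 𝕜 (r + 1) (levelBound c j) v → ∀ N', ∀ x ∈ block E (m (j + 1)) N', ‖x‖ ≤ 1 →
        TailBound 𝕜 r (levelBound c (j + 1)) (v + x) := by
  have h1 : ∀ j M : ℕ, ∃ N, M < N ∧ ∀ r ≤ j, ∀ v ∈ block E 0 M,
      TailBound 𝕜 (r + 1) (levelBound c j) v → ∀ N', ∀ x ∈ block E N N', ‖x‖ ≤ 1 →
        TailBound 𝕜 r (levelBound c (j + 1)) (v + x) := by
    intro j M
    exact ((eventually_gt_atTop M).and ((eventually_all_finite (Set.finite_Iic j)).2 fun r _ =>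
      h.eventually_tailBound M r (levelBound_strictMono c j.lt_succ_self))).exists
  choose next hlt hnext using h1
  let m : ℕ → ℕ := fun j => Nat.rec 0 (fun j M => next j M) j
  exact ⟨m, rfl, strictMono_nat_of_lt_succ fun j => hlt j (m j), fun j => hnext j (m j)⟩

/-- Sums of at most `b 0 + 1` blocks are bounded if successive blocks are separated by gaps. -/
lemma norm_sum_le_of_gaps {c : ℝ} {m : ℕ → ℕ} (hm : StrictMono m)
    (hm' : ∀ j, ∀ r ≤ j, ∀ v ∈ block E 0 (m j),
      TailBound 𝕜 (r + 1) (levelBound c j) v → ∀ N', ∀ x ∈ block E (m (j + 1)) N', ‖x‖ ≤ 1 →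
        TailBound 𝕜 r (levelBound c (j + 1)) (v + x))
    (hc : ∀ n, TailBound 𝕜 n c (0 : X)) {l : ℕ} {a b : ℕ → ℕ} {x : ℕ → X} (hl : l ≤ b 0 + 1)
    (hba : ∀ i, b i < a i) (hab : ∀ i, a i ≤ b (i + 1))
    (hx : ∀ i, x i ∈ block E (m (a i)) (m (b (i + 1)))) (hx1 : ∀ i, ‖x i‖ ≤ 1) :
    ‖∑ i ∈ Finset.range l, x i‖ ≤ c + 1 := by
  have hb : StrictMono b := strictMono_nat_of_lt_succ fun i => (hba i).trans_le (hab i)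
  have key : ∀ i ≤ l, ∑ i' ∈ Finset.range i, x i' ∈ block E 0 (m (b i)) ∧
      TailBound 𝕜 (l - i) (levelBound c (b i)) (∑ i' ∈ Finset.range i, x i') := by
    intro i
    induction i with
    | zero => exact fun _ => ⟨by simp, by simpa using (hc l).mono (le_levelBound c _)⟩
    | succ i ih =>
      intro hi
      obtain ⟨h1, h2⟩ := ih (by omega)
      have h3 : b 0 ≤ b i := hb.monotone (Nat.zero_le i)
      have h4 : l - i = l - (i + 1) + 1 := by omega
      rw [h4] at h2
      rw [Finset.sum_range_succ]
      refine ⟨add_mem (block_mono le_rfl (hm.monotone (hb i.lt_succ_self).le) h1)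
        (block_mono (Nat.zero_le _) le_rfl (hx i)), ?_⟩
      have h5 := hm' (b i) (l - (i + 1)) (by omega) _ h1 h2 (m (b (i + 1))) (x i)
        (block_mono (hm.monotone (hba i)) le_rfl (hx i)) (hx1 i)
      exact h5.mono ((levelBound_strictMono c).monotone ((hba i).trans_le (hab i)))
  exact (key l le_rfl).2.norm_le.trans (levelBound_le c _)

lemma sum_range_two_mul_add_one {M : Type*} [AddCommMonoid M] (x : ℕ → M) (n : ℕ) :
    ∑ i ∈ Finset.range (2 * n + 1), x i = x 0 + ∑ i ∈ Finset.range n, x (2 * i + 1) +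
      ∑ i ∈ Finset.range n, x (2 * i + 2) := by
  induction n with
  | zero => simp
  | succ n ih =>
    rw [show 2 * (n + 1) + 1 = 2 * n + 1 + 1 + 1 by ring, Finset.sum_range_succ,
      Finset.sum_range_succ, ih, Finset.sum_range_succ, Finset.sum_range_succ]
    abel

/-- Sums of `n` successive blocks starting after the `n`-th one are bounded: after removal of
the first block, the blocks with odd and with even number have gaps. -/
lemma norm_sum_le_of_blocks {c : ℝ} {m : ℕ → ℕ} (hm : StrictMono m)
    (hm' : ∀ j, ∀ r ≤ j, ∀ v ∈ block E 0 (m j),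
      TailBound 𝕜 (r + 1) (levelBound c j) v → ∀ N', ∀ x ∈ block E (m (j + 1)) N', ‖x‖ ≤ 1 →
        TailBound 𝕜 r (levelBound c (j + 1)) (v + x))
    (hc : ∀ n, TailBound 𝕜 n c (0 : X)) {n : ℕ} {k : ℕ → ℕ} (hk : StrictMono k) (hn : n ≤ k 0 + 1)
    {x : ℕ → X} (hx : ∀ i, x i ∈ block E (m (k i)) (m (k (i + 1)))) (hx1 : ∀ i, ‖x i‖ ≤ 1) :
    ‖∑ i ∈ Finset.range (2 * n + 1), x i‖ ≤ 2 * c + 3 := by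
  have h1 := norm_sum_le_of_gaps hm hm' hc (l := n) (a := fun i => k (2 * i + 1))
    (b := fun i => k (2 * i)) (x := fun i => x (2 * i + 1)) hn (fun i => hk (Nat.lt_succ_self _))
    (fun i => (hk (by omega)).le) (fun i => hx (2 * i + 1)) (fun i => hx1 _)
  have h2 := norm_sum_le_of_gaps hm hm' hc (l := n) (a := fun i => k (2 * i + 2))
    (b := fun i => k (2 * i + 1)) (x := fun i => x (2 * i + 2))
    (hn.trans (by have := hk (Nat.lt_succ_self 0); simp at this ⊢; omega))
    (fun i => hk (Nat.lt_succ_self _))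
    (fun i => (hk (by omega)).le) (fun i => hx (2 * i + 2)) (fun i => hx1 _)
  rw [sum_range_two_mul_add_one]
  refine (norm_add₃_le).trans ?_
  linarith [hx1 0]

theorem IsShrinking.exists_isAsymptoticC0In [CompleteSpace X] {hE : IsFDD E} (h : IsShrinking hE)
    (hX : opSigma (ContinuousLinearMap.id 𝕜 X) < ⊤) :
    ∃ F : ℕ → Submodule 𝕜 X, IsBlocking F E ∧ IsAsymptoticC0In F := by
  obtain ⟨c, hc⟩ := (opSigma_lt_top_iff _).1 hX
  have hc' : ∀ n, TailBound 𝕜 n c (0 : X) := fun n => (hc n).mono fun z hz => by simpa using hz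
  have hc0 : 0 ≤ c := (norm_nonneg _).trans (hc' 0).norm_le
  obtain ⟨m, hm0, hm, hm'⟩ := h.exists_blocking c
  obtain ⟨P, C, hC0, hP, hPC⟩ := hE.exists_continuousLinearMap
  have hF : ∀ j, (fun j => block E (m j) (m (j + 1))) j = block E (m j) (m (j + 1)) := fun _ => rfl
  refine ⟨fun j => block E (m j) (m (j + 1)), ⟨m, hm0, hm, fun j => rfl⟩,
    max (2 * c + 3) (2 * C), le_max_of_le_left (by linarith), fun n hn k hk hnk x hx => ?_⟩
  have hpos : 0 < max (2 * c + 3) (2 * C) := lt_max_of_lt_left (by linarith)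
  have hx' : ∀ i, x i ∈ block E (m (k i.castSucc)) (m (k i.succ)) := fun i => by
    rw [← block_blocking hm hF (hk i.castSucc_lt_succ).le]
    exact hx i
  constructor
  · rw [inv_mul_le_iff₀ hpos]
    refine (pi_norm_le_iff_of_nonneg (by positivity)).2 fun i => ?_
    have h1 : P (m (k i.succ)) (∑ j, x j) - P (m (k i.castSucc)) (∑ j, x j) = x i := by
      rw [map_sum, map_sum, ← Finset.sum_sub_distrib, Finset.sum_eq_single i]
      · rw [eq_self_of_mem_block hE hP le_rfl (hx' i), eq_zero_of_mem_block hE hP le_rfl (hx' i),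
          sub_zero]
      · intro j _ hji
        rcases lt_or_gt_of_ne hji with hlt | hgt
        · have h2 : m (k j.succ) ≤ m (k i.castSucc) :=
            hm.monotone (hk.monotone (Fin.succ_le_castSucc_iff.2 hlt))
          rw [eq_self_of_mem_block hE hP (h2.trans (hm.monotone (hk.monotone
            i.castSucc_lt_succ.le))) (hx' j), eq_self_of_mem_block hE hP h2 (hx' j), sub_self]
        · have h2 : m (k i.succ) ≤ m (k j.castSucc) :=
            hm.monotone (hk.monotone (Fin.succ_le_castSucc_iff.2 hgt))
          rw [eq_zero_of_mem_block hE hP h2 (hx' j), eq_zero_of_mem_block hE hP ((hm.monotone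
            (hk.monotone i.castSucc_lt_succ.le)).trans h2) (hx' j), sub_self]
      · exact fun hi => absurd (Finset.mem_univ i) hi
    rw [← h1]
    refine (norm_sub_le _ _).trans ?_
    have h2 := hPC (m (k i.succ)) (∑ j, x j)
    have h3 := hPC (m (k i.castSucc)) (∑ j, x j)
    have h4 := mul_le_mul_of_nonneg_right (le_max_right (2 * c + 3) (2 * C))
      (norm_nonneg (∑ j, x j))
    linarith
  · refine le_trans ?_ (mul_le_mul_of_nonneg_right (le_max_left _ _) (norm_nonneg x))
    rcases eq_or_ne x 0 with rfl | hx0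
    · simp
    have hxpos : 0 < ‖x‖ := norm_pos_iff.2 hx0
    -- The sequences `k` and `x`, the latter normalized, are extended beyond their last terms.
    let k' : ℕ → ℕ := fun i => k (Fin.ofNat (n + 1) (min i n)) + (i - n)
    let x' : ℕ → X := fun i => if hi : i < n then ((‖x‖⁻¹ : ℝ) : 𝕜) • x ⟨i, hi⟩ else 0
    have hk'1 : ∀ i : Fin (n + 1), k' i = k i := by
      intro i
      have h1 : min (i : ℕ) n = i := min_eq_left (by omega)
      have h2 : (i : ℕ) - n = 0 := by omega
      simp only [k', h1, h2, add_zero]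
      congr 1
      exact Fin.ext (Nat.mod_eq_of_lt i.2)
    have hk' : StrictMono k' := by
      refine strictMono_nat_of_lt_succ fun i => ?_
      rcases lt_or_ge i n with hi | hi
      · have h1 := hk'1 (Fin.castSucc ⟨i, hi⟩)
        have h2 := hk'1 (Fin.succ ⟨i, hi⟩)
        simp only [Fin.val_castSucc, Fin.val_succ] at h1 h2
        rw [h1, h2]
        exact hk Fin.castSucc_lt_succ
      · have h1 : min i n = n := min_eq_right hi
        have h2 : min (i + 1) n = n := min_eq_right (by omega)
        simp only [k', h1, h2]
        omega
    have h0 : k' 0 = k 0 := hk'1 0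
    have h1 := norm_sum_le_of_blocks hm hm' hc' (n := n) hk' (by rwa [h0]) (x := x')
      (fun i => by
        simp only [x']
        split_ifs with hi
        · have h1 := hk'1 (Fin.castSucc ⟨i, hi⟩)
          have h2 := hk'1 (Fin.succ ⟨i, hi⟩)
          simp only [Fin.val_castSucc, Fin.val_succ] at h1 h2
          rw [h1, h2]
          exact Submodule.smul_mem _ _ (hx' ⟨i, hi⟩)
        · exact zero_mem _)
      (fun i => by
        simp only [x']
        split_ifs with hi
        · rw [norm_smul, RCLike.norm_ofReal, abs_of_pos (inv_pos.2 hxpos),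
            inv_mul_le_iff₀ hxpos, mul_one]
          exact norm_le_pi_norm x _
        · simp)
    have h2 : ∑ i ∈ Finset.range (2 * n + 1), x' i = ((‖x‖⁻¹ : ℝ) : 𝕜) • ∑ i, x i := by
      rw [← Finset.sum_subset (Finset.range_subset_range.2 (show n ≤ 2 * n + 1 by omega))
        (fun i _ hi => dif_neg (by simpa using hi)), Finset.sum_range, Finset.smul_sum]
      exact Finset.sum_congr rfl fun i _ => dif_pos i.2
    rw [h2, norm_smul, RCLike.norm_ofReal, abs_of_pos (inv_pos.2 hxpos),
      inv_mul_le_iff₀ hxpos, mul_comm] at h1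
    exact h1

end Blocking

end SummableSzlenk

theorem mainTheorem7 {𝕜 : Type*} [RCLike 𝕜]
    {X : Type u} [NormedAddCommGroup X] [NormedSpace 𝕜 X] [CompleteSpace X]
    {Y : Type v} [NormedAddCommGroup Y] [NormedSpace 𝕜 Y] [CompleteSpace Y] :
    (∀ A : X →L[𝕜] Y,
      SummableSzlenk.opSigma A < ⊤ ↔ SummableSzlenk.OpHasSummableSzlenk A) ∧
    (¬ FiniteDimensional 𝕜 X →
      List.TFAE [
        SummableSzlenk.opSigma (ContinuousLinearMap.id 𝕜 X) < ⊤,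
        SummableSzlenk.OpHasSummableSzlenk (ContinuousLinearMap.id 𝕜 X),
        SummableSzlenk.IsAsymptoticC0 𝕜 X]) ∧
    (¬ FiniteDimensional 𝕜 X →
      ∀ (E : ℕ → Submodule 𝕜 X) (hE : SummableSzlenk.IsFDD E), SummableSzlenk.IsShrinking hE →
        List.TFAE [
          SummableSzlenk.opSigma (ContinuousLinearMap.id 𝕜 X) < ⊤,
          SummableSzlenk.OpHasSummableSzlenk (ContinuousLinearMap.id 𝕜 X),
          SummableSzlenk.IsAsymptoticC0 𝕜 X,
          ∃ F : ℕ → Submodule 𝕜 X,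
            SummableSzlenk.IsBlocking F E ∧ SummableSzlenk.IsAsymptoticC0In F]) := by
  refine ⟨SummableSzlenk.opSigma_lt_top_iff_hasSummableSzlenk, fun hX => ?_, fun hX E hE hS => ?_⟩
  · tfae_have 1 ↔ 2 := SummableSzlenk.opSigma_lt_top_iff_hasSummableSzlenk _
    tfae_have 1 → 3 := SummableSzlenk.isAsymptoticC0_of_opSigma_lt_top hX
    tfae_have 3 → 1 := SummableSzlenk.opSigma_lt_top_of_isAsymptoticC0
    tfae_finish
  · tfae_have 1 ↔ 2 := SummableSzlenk.opSigma_lt_top_iff_hasSummableSzlenk _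
    tfae_have 1 → 3 := SummableSzlenk.isAsymptoticC0_of_opSigma_lt_top hX
    tfae_have 3 → 1 := SummableSzlenk.opSigma_lt_top_of_isAsymptoticC0
    tfae_have 1 → 4 := hS.exists_isAsymptoticC0In
    tfae_have 4 → 1 := fun ⟨_, hFE, hF⟩ => SummableSzlenk.opSigma_lt_top_of_isBlocking hE hFE hF
    tfae_finish
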